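/- Let $S^2\subset\mathbb R^3$ be the unit sphere, $|\cdot|$ its surface measure, and $\operatorname{Uni}(S^2)$ the normalised surface measure. Let $e,u\in S^2$ with $u\neq e$ (entry velocity and first outgoing velocity), let $R>0$, and let $v\in S^2$, $v\ne u$. A point particle arrives at the origin with velocity $e$ at time $0$, moves with velocity $u$ on $(0,R)$, and leaves the point $Ru$ at time $\xi=R$ with velocity $v$. From then on it moves freely with elastic reflection at the two fixed balls of radius $1$ with centres $$a=\frac{e-u}{|e-u|},\qquad b=Ru+\frac{u-v}{|u-v|}$$ (which account for the first collision, at the origin, and for the second one, at $Ru$). Let $N$ be the total number of collisions, the first two included, and let $\tilde w$ be the velocity after the last collision. Let $v$ be distributed according to $\operatorname{Uni}(S^2)$, and let $P(\,\cdot\mid \xi=R,\,u,\,N=3)$ denote the conditional probability given $N=3$, for the entry velocity $e$ and the given $u$ and $\xi=R$. Then there is a constant $C>0$ such that for all $e,u\in S^2$ with $u\ne e$ and all $R>0$ the event $N=3$ has positive probability and $$\sup_{A\subset S^2\text{ Borel}}\Bigl|P\bigl(\tilde w\in A\mid \xi=R,\,u,\,N=3\bigr)-\frac{|A|}{|S^2|}\Bigr|\le\frac{C}{1+R}.$$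 In particular, the conditional exit distribution becomes independent of the entry velocity as $R\to\infty$: the total variation distance between the conditional distributions of $\tilde w$ for $(e,u)$ and for $(e',u')$ tends to $0$ as $R\to\infty$, uniformly in all $e,u,e',u'\in S^2$ with $u\neq e$ and $u'\ne e'$. -/

import Mathlib

open MeasureTheory Metric
open scoped RealInnerProductSpace

noncomputable section

namespace LorentzRecollision

/-- Physical space `ℝ³` with its Euclidean norm. -/
abbrev E3 : Type := EuclideanSpace ℝ (Fin 3)

/-- The unit sphere `S²` of `ℝ³`. -/
abbrev S2 : Type := sphere (0 : E3) 1

/-- The surface measure on `S²` (total mass `4π`). -/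
def surface : Measure S2 := (volume : Measure E3).toSphere

/-- The uniform distribution `Uni(S²)`: the normalised surface measure. -/
def uni : Measure S2 := (surface Set.univ)⁻¹ • surface

/-- Centre of the first scatterer (radius `1`): at the origin it turns the velocity `e` into `u`. -/
def centerA (e u : S2) : E3 := ‖(e : E3) - u‖⁻¹ • ((e : E3) - u)

/-- Centre of the second scatterer (radius `1`): at `ξ u` it turns the velocity `u` into `v`. -/
def centerB (u : S2) (ξ : ℝ) (v : S2) : E3 :=
  ξ • (u : E3) + ‖(u : E3) - v‖⁻¹ • ((u : E3) - v)

/-- The positive times at which a particle moving freely from `x` with velocity `w` lies in the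
open unit ball centred at `c`. -/
def hitTimes (c x w : E3) : Set ℝ := {t | 0 < t ∧ ‖x + t • w - c‖ < 1}

/-- Elastic reflection of the velocity `w` at the point `y` of the unit sphere centred at `c`. -/
def reflectAt (c y w : E3) : E3 := w - (2 * ⟪w, y - c⟫) • (y - c)

/-- The state (position, outgoing velocity) after a free flight from `s = (x, w)` to the scatterer
centred at `c` and an elastic collision with it. -/
def collideWith (c : E3) (s : E3 × E3) : E3 × E3 :=
  let y := s.1 + sInf (hitTimes c s.1 s.2) • s.2
  (y, reflectAt c y s.2)

open Classical in
/-- The next collision of a particle that leaves `s = (x, w)` in the presence of the two fixed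
unit scatterers centred at `a` and `b`: it collides with the scatterer that it enters first.
The value is `none` when there is no further collision. -/
def nextCollision (a b : E3) (s : E3 × E3) : Option (E3 × E3) :=
  if (hitTimes a s.1 s.2).Nonempty ∧
      ∀ t ∈ hitTimes b s.1 s.2, sInf (hitTimes a s.1 s.2) ≤ t then
    some (collideWith a s)
  else if (hitTimes b s.1 s.2).Nonempty then
    some (collideWith b s)
  else none

/-- The position and outgoing velocity `(Z(τ_k), w_k)` at the `k`-th collision of the recollision
process with entry velocity `e` determined by `(u, ξ, v)`; `none` if there is no `k`-th collision.
The first two collisions are prescribed: at the origin, to velocity `u`, and at `ξ u`, to velocity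
`v`. The later ones are those of the billiard outside the two scatterers.
The entry `k = 0` only records the entry velocity `w_0 = e`. -/
def collision (e u : S2) (ξ : ℝ) (v : S2) : ℕ → Option (E3 × E3)
  | 0 => some (0, e)
  | 1 => some (0, u)
  | 2 => some (ξ • (u : E3), v)
  | k + 3 => (collision e u ξ v (k + 2)).bind (nextCollision (centerA e u) (centerB u ξ v))

/-- The total number `N` of collisions of the process (`⊤` if there are infinitely many). -/
def numCollisions (e u : S2) (ξ : ℝ) (v : S2) : ℕ∞ :=
  ⨆ k ∈ {k : ℕ | (collision e u ξ v k).isSome}, (k : ℕ∞)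

/-- The exit velocity `w_N`, the velocity after the last collision
(meaningful when `N` is finite). -/
def exitVelocity (e u : S2) (ξ : ℝ) (v : S2) : E3 :=
  ((collision e u ξ v (numCollisions e u ξ v).toNat).map Prod.snd).getD 0

/-- The event `N = 3` of a simple direct recollision, given `ξ = R` and first outgoing velocity
`u`, as a set of second outgoing velocities `v`. -/
def simpleRecollision (e u : S2) (R : ℝ) : Set S2 := {v | numCollisions e u R v = 3}

/-- The conditional probability `P(w_N ∈ A | ξ = R, u, N = 3)`. The variables `u, ξ, v` being
independent with `v` uniform on `S²`, conditioning on `ξ = R` and on `u` leaves `v` uniform. -/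
def condExitProb (e u : S2) (R : ℝ) (A : Set S2) : ℝ :=
  (ProbabilityTheory.cond uni (simpleRecollision e u R)).real
    {v | exitVelocity e u R v ∈ ((↑) '' A : Set E3)}

end LorentzRecollision

end

/-! When N = 3, the exit velocity is the result of a single scattering: the particle starts from `R
• u` in a uniform direction `v`, hits the first ball, and leaves. Seen from `R • u`, that ball has
its centre at distance d > max(1, R), in a direction z. The theorem thus reduces to two facts: a
distant ball scatters nearly isotropically, and a fourth collision is rare among the `v` that hit
the ball.

Isotropy. With polar axis z the surface measure is dc dφ (Archimedes), and scattering preserves the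
azimuth φ (`scatter_spherePoint`), so only the law of the scattered cosine matters. Let s be the
cosine of the angle of incidence. The source density in s is s / (d² C), where C = `sourceCos d s`
is close to 1, and the scattered cosine F(s) = `scatterProfile d s` is 1 - 2s² + O(1/d). With κ =
`capFraction d` ≈ 1/(4d²), the probability of hitting the ball, both s / (d² C) and -κ F'(s) are
s/d² to leading order, and they differ by at most κ · 9/d (`abs_density_sub_le`). Since the error is
proportional to κ, it survives conditioning on the rare event of a hit
(`abs_uni_scatterInto_sub_le`).

Fourth collision. A particle that goes back to the second ball must leave the first one within a cap
of measure O(1/R²) around `u` (`multipleRecollision_subset`). By the isotropy estimate, the `v`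
scattered into that cap have measure at most κ · O(1/R). Removing them from the hitting directions
changes the conditional law by O(1/R).

For small R the bound is trivial once N = 3 has positive probability. That follows from an open set
of grazing directions, for which the second ball is missed. -/

noncomputable section

namespace LorentzRecollision

open scoped ENNReal

/-! ### Spherical coordinates and Archimedes' theorem. -/

/-- The volume of `ℝ³` in the coordinates of an orthonormal basis. -/
lemma lintegral_eq_lintegral_coords (b : OrthonormalBasis (Fin 3) ℝ E3) (F : E3 → ℝ≥0∞)
    (hF : Measurable F) :
    ∫⁻ x, F x = ∫⁻ a : ℝ, ∫⁻ p : ℝ × ℝ, F (a • b 0 + p.1 • b 1 + p.2 • b 2) := by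
  have h1 := b.measurePreserving_repr_symm
  have h2 := PiLp.volume_preserving_toLp (Fin 3)
  have h3 := (volume_preserving_piFinSuccAbove (fun _ : Fin 3 => ℝ) 0).symm
  have h4 := (volume_preserving_finTwoArrow ℝ).symm
  rw [← h1.lintegral_comp hF,
    ← h2.lintegral_comp (f := fun x => F (b.repr.symm x)) (hF.comp h1.measurable),
    ← h3.lintegral_comp (f := fun x => F (b.repr.symm (WithLp.toLp 2 x)))
      ((hF.comp h1.measurable).comp h2.measurable)]
  have hm := ((hF.comp h1.measurable).comp h2.measurable).comp h3.measurable
  have := lintegral_prod (μ := (volume : Measure ℝ)) (ν := (volume : Measure (Fin 2 → ℝ)))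
    (fun q => F (b.repr.symm (WithLp.toLp 2
      ((MeasurableEquiv.piFinSuccAbove (fun _ : Fin 3 => ℝ) 0).symm q)))) hm.aemeasurable
  refine this.trans ?_
  refine lintegral_congr fun a => ?_
  rw [← h4.lintegral_comp (f := fun y => F (b.repr.symm (WithLp.toLp 2
      ((MeasurableEquiv.piFinSuccAbove (fun _ : Fin 3 => ℝ) 0).symm (a, y)))))
      (hm.comp measurable_prodMk_left)]
  refine lintegral_congr fun p => ?_
  congr 1
  rw [← b.sum_repr_symm, Fin.sum_univ_three]
  rfl

/-- Spherical coordinates in `ℝ³`, the polar axis being the first vector of the basis. -/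
lemma lintegral_eq_lintegral_spherical (b : OrthonormalBasis (Fin 3) ℝ E3) (F : E3 → ℝ≥0∞)
    (hF : Measurable F) :
    ∫⁻ x, F x = ∫⁻ φ in Set.Ioo (-Real.pi) Real.pi, ∫⁻ θ in Set.Ioo 0 Real.pi,
      ∫⁻ r in Set.Ioi (0 : ℝ), ENNReal.ofReal (r ^ 2 * Real.sin θ) *
        F (r • (Real.cos θ • b 0 + Real.sin θ • (Real.cos φ • b 1 + Real.sin φ • b 2))) := by
  rw [lintegral_eq_lintegral_coords b F hF]
  have e1 : ∀ a : ℝ, ∫⁻ p : ℝ × ℝ, F (a • b 0 + p.1 • b 1 + p.2 • b 2) =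
      ∫⁻ φ in Set.Ioo (-Real.pi) Real.pi, ∫⁻ ρ in Set.Ioi (0 : ℝ), ENNReal.ofReal ρ *
        F (a • b 0 + ρ • (Real.cos φ • b 1 + Real.sin φ • b 2)) := by
    intro a
    rw [← lintegral_comp_polarCoord_symm, polarCoord_target, Measure.volume_eq_prod,
      setLIntegral_prod_symm]
    · simp only [polarCoord_symm_apply, smul_eq_mul, smul_add, mul_smul, add_assoc]
    · simp only [polarCoord_symm_apply, smul_eq_mul]
      exact (by fun_prop : Measurable _).aemeasurable
  simp_rw [e1]
  rw [lintegral_lintegral_swap]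
  swap
  · refine Measurable.aemeasurable ?_
    refine Measurable.lintegral_prod_right (f := fun (q : ℝ × ℝ) (ρ : ℝ) => ENNReal.ofReal ρ *
        F (q.1 • b 0 + ρ • (Real.cos q.2 • b 1 + Real.sin q.2 • b 2))) ?_
    fun_prop
  refine lintegral_congr fun φ => ?_
  set w : E3 := Real.cos φ • b 1 + Real.sin φ • b 2
  -- Extending the integrand by zero to ρ ≤ 0 allows a second use of plane polar coordinates, now in
  -- (a, ρ). The angles θ ≤ 0 then contribute nothing.
  let G : ℝ × ℝ → ℝ≥0∞ := fun q => (Set.Ioi (0 : ℝ)).indicator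
    (fun ρ => ENNReal.ofReal ρ * F (q.1 • b 0 + ρ • w)) q.2
  have hG : Measurable G := by
    have : G = Set.indicator {q : ℝ × ℝ | 0 < q.2}
      (fun q => ENNReal.ofReal q.2 * F (q.1 • b 0 + q.2 • w)) := by
      ext q; simp [G, Set.indicator_apply]
    rw [this]
    exact Measurable.indicator (by fun_prop) (measurableSet_lt measurable_const measurable_snd)
  have e2 : ∀ a : ℝ, ∫⁻ ρ in Set.Ioi (0 : ℝ), ENNReal.ofReal ρ * F (a • b 0 + ρ • w) =
      ∫⁻ ρ, G (a, ρ) := fun a => (lintegral_indicator measurableSet_Ioi _).symm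
  simp_rw [e2]
  rw [← lintegral_prod _ hG.aemeasurable, ← Measure.volume_eq_prod,
    ← lintegral_comp_polarCoord_symm, polarCoord_target, Measure.volume_eq_prod,
      setLIntegral_prod_symm]
  swap
  · simp only [polarCoord_symm_apply, smul_eq_mul]
    exact (by fun_prop : Measurable _).aemeasurable
  simp only [polarCoord_symm_apply, smul_eq_mul]
  rw [← lintegral_indicator measurableSet_Ioo, ← lintegral_indicator measurableSet_Ioo]
  refine lintegral_congr fun θ => ?_
  by_cases h0 : θ ∈ Set.Ioo 0 Real.pi
  · have h0' : θ ∈ Set.Ioo (-Real.pi) Real.pi := ⟨by linarith [h0.1, Real.pi_pos], h0.2⟩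
    rw [Set.indicator_of_mem h0, Set.indicator_of_mem h0']
    refine setLIntegral_congr_fun measurableSet_Ioi fun r hr => ?_
    have hs := Real.sin_pos_of_mem_Ioo h0
    have hr' : 0 < r := hr
    have : 0 < r * Real.sin θ := mul_pos hr hs
    simp only [G]
    rw [Set.indicator_of_mem (by exact this), ← mul_assoc,
      ← ENNReal.ofReal_mul hr'.le]
    congr 2
    · ring
    · simp only [w, smul_add, smul_smul, mul_assoc]
  · rw [Set.indicator_of_notMem h0]
    by_cases h1 : θ ∈ Set.Ioo (-Real.pi) Real.pi
    · rw [Set.indicator_of_mem h1]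
      refine setLIntegral_eq_zero measurableSet_Ioi fun r hr => ?_
      have hθ : θ ≤ 0 := by
        by_contra h; exact h0 ⟨not_le.1 h, h1.2⟩
      have hs := Real.sin_nonpos_of_nonpos_of_neg_pi_le hθ h1.1.le
      have : ¬ 0 < r * Real.sin θ := by
        have hr' : 0 < r := hr
        nlinarith
      simp [G, Set.indicator_of_notMem (show r * Real.sin θ ∉ Set.Ioi 0 from this)]
    · rw [Set.indicator_of_notMem h1]

/-- The point of the unit sphere with height `c` over the equatorial plane of `b 0` and azimuth
`φ`. -/
def spherePoint (b : OrthonormalBasis (Fin 3) ℝ E3) (c φ : ℝ) : E3 :=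
  c • b 0 + √(1 - c ^ 2) • (Real.cos φ • b 1 + Real.sin φ • b 2)

lemma norm_combination (b : OrthonormalBasis (Fin 3) ℝ E3) (x y φ : ℝ) :
    ‖x • b 0 + y • (Real.cos φ • b 1 + Real.sin φ • b 2)‖ ^ 2 = x ^ 2 + y ^ 2 := by
  have h : ∀ i j, ⟪b i, b j⟫ = if i = j then (1 : ℝ) else 0 :=
    fun i j => orthonormal_iff_ite.1 b.orthonormal i j
  rw [← real_inner_self_eq_norm_sq]
  simp only [inner_add_left, inner_add_right, inner_smul_left, inner_smul_right, h]
  simp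
  linear_combination y ^ 2 * Real.cos_sq_add_sin_sq φ

lemma inner_combination (b : OrthonormalBasis (Fin 3) ℝ E3) (x y φ : ℝ) :
    ⟪x • b 0 + y • (Real.cos φ • b 1 + Real.sin φ • b 2), b 0⟫ = x := by
  have h : ∀ i j, ⟪b i, b j⟫ = if i = j then (1 : ℝ) else 0 :=
    fun i j => orthonormal_iff_ite.1 b.orthonormal i j
  simp only [inner_add_left, inner_smul_left, h]
  simp

lemma norm_spherePoint (b : OrthonormalBasis (Fin 3) ℝ E3) {c : ℝ} (hc : c ∈ Set.Ioo (-1 : ℝ) 1)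
    (φ : ℝ) : ‖spherePoint b c φ‖ = 1 := by
  have h := norm_combination b c (√(1 - c ^ 2)) φ
  rw [Real.sq_sqrt (by nlinarith [hc.1, hc.2])] at h
  have : ‖spherePoint b c φ‖ ^ 2 = 1 := h.trans (by ring)
  nlinarith [norm_nonneg (spherePoint b c φ)]

lemma inner_spherePoint (b : OrthonormalBasis (Fin 3) ℝ E3) (c φ : ℝ) :
    ⟪spherePoint b c φ, b 0⟫ = c := inner_combination b _ _ _

lemma measurable_spherePoint (b : OrthonormalBasis (Fin 3) ℝ E3) :
    Measurable (fun q : ℝ × ℝ => spherePoint b q.1 q.2) := by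
  unfold spherePoint; fun_prop

open scoped Pointwise in
/-- Archimedes: the surface measure in cylindrical coordinates. -/
lemma surface_eq_lintegral (b : OrthonormalBasis (Fin 3) ℝ E3) {A : Set S2}
    (hA : MeasurableSet A) :
    surface A = ∫⁻ φ in Set.Ioo (-Real.pi) Real.pi,
      volume (Set.Ioo (-1 : ℝ) 1 ∩ {c | spherePoint b c φ ∈ ((↑) '' A : Set E3)}) := by
  have hA' : MeasurableSet ((↑) '' A : Set E3) :=
    (MeasurableEmbedding.subtype_coe isClosed_sphere.measurableSet).measurableSet_image.2 hA
  -- `toSphere` is the dimension times the volume of the cone over `A`. The radial integral of r²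
  -- gives 1/3, which later cancels that factor 3.
  have hcone : Set.Ioo (0 : ℝ) 1 • ((↑) '' A : Set E3) =
      {x : E3 | ‖x‖ ∈ Set.Ioo (0 : ℝ) 1 ∧ ‖x‖⁻¹ • x ∈ ((↑) '' A : Set E3)} := by
    ext x
    constructor
    · rintro ⟨r, hr, _, ⟨v, hv, rfl⟩, rfl⟩
      have hn : ‖r • (v : E3)‖ = r := by
        rw [norm_smul, Real.norm_of_nonneg hr.1.le, norm_eq_of_mem_sphere, mul_one]
      refine ⟨?_, ?_⟩
      · simpa only [hn] using hr
      · simp only [hn]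
        rw [smul_smul, inv_mul_cancel₀ hr.1.ne', one_smul]
        exact ⟨v, hv, rfl⟩
    · rintro ⟨h1, h2⟩
      exact ⟨‖x‖, h1, _, h2, by simp only [smul_smul, mul_inv_cancel₀ h1.1.ne', one_smul]⟩
  set C := {x : E3 | ‖x‖ ∈ Set.Ioo (0 : ℝ) 1 ∧ ‖x‖⁻¹ • x ∈ ((↑) '' A : Set E3)}
  have hC : MeasurableSet C :=
    (measurable_norm measurableSet_Ioo).inter
      ((measurable_norm.inv.smul measurable_id : Measurable fun x : E3 => ‖x‖⁻¹ • x) hA')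
  rw [surface, Measure.toSphere_apply' _ hA, hcone, ← lintegral_indicator_one hC,
    lintegral_eq_lintegral_spherical b _ (measurable_one.indicator hC),
    ← lintegral_const_mul' _ _ (by simp)]
  refine setLIntegral_congr_fun measurableSet_Ioo fun φ _ => ?_
  have hB : MeasurableSet {c | spherePoint b c φ ∈ ((↑) '' A : Set E3)} :=
    ((measurable_spherePoint b).comp (measurable_id.prodMk measurable_const)) hA'
  set B := {c | spherePoint b c φ ∈ ((↑) '' A : Set E3)}
  have himg : Real.cos '' Set.Ioo 0 Real.pi = Set.Ioo (-1) 1 := by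
    ext c
    constructor
    · rintro ⟨θ, hθ, rfl⟩
      have h1 := Real.strictAntiOn_cos ⟨le_rfl, Real.pi_pos.le⟩ ⟨hθ.1.le, hθ.2.le⟩ hθ.1
      have h2 := Real.strictAntiOn_cos ⟨hθ.1.le, hθ.2.le⟩ ⟨Real.pi_pos.le, le_rfl⟩ hθ.2
      rw [Real.cos_zero] at h1
      rw [Real.cos_pi] at h2
      exact ⟨h2, h1⟩
    · intro hc
      exact ⟨Real.arccos c, ⟨Real.arccos_pos.2 hc.2, Real.arccos_lt_pi.2 hc.1⟩,
        Real.cos_arccos hc.1.le hc.2.le⟩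
  have key := lintegral_image_eq_lintegral_deriv_mul_of_antitoneOn
    (s := Set.Ioo 0 Real.pi) measurableSet_Ioo
    (fun x _ => (Real.hasDerivAt_cos x).hasDerivWithinAt)
    (Real.strictAntiOn_cos.antitoneOn.mono Set.Ioo_subset_Icc_self) (B.indicator 1)
  rw [himg, lintegral_indicator_one hB, Measure.restrict_apply hB, Set.inter_comm] at key
  rw [key, ← lintegral_const_mul' _ _ (by simp)]
  refine setLIntegral_congr_fun measurableSet_Ioo fun θ hθ => ?_
  have hs := Real.sin_pos_of_mem_Ioo hθ
  have hpt : Real.cos θ • b 0 + Real.sin θ • (Real.cos φ • b 1 + Real.sin φ • b 2) =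
      spherePoint b (Real.cos θ) φ := by
    rw [spherePoint, ← Real.sin_sq, Real.sqrt_sq hs.le]
  have hcos : Real.cos θ ∈ Set.Ioo (-1 : ℝ) 1 := himg ▸ Set.mem_image_of_mem _ hθ
  simp only [hpt, neg_neg]
  have hr : ∀ r ∈ Set.Ioi (0 : ℝ), ENNReal.ofReal (r ^ 2 * Real.sin θ) *
      C.indicator 1
        (r • spherePoint b (Real.cos θ) φ) =
      (ENNReal.ofReal (Real.sin θ) * B.indicator 1 (Real.cos θ)) *
        (Set.Ioo (0 : ℝ) 1).indicator (fun r => ENNReal.ofReal (r ^ 2)) r := by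
    intro r hr
    have hr' : 0 < r := hr
    have hn : ‖r • spherePoint b (Real.cos θ) φ‖ = r := by
      rw [norm_smul, Real.norm_of_nonneg hr'.le, norm_spherePoint b hcos, mul_one]
    have hmem : r • spherePoint b (Real.cos θ) φ ∈ C ↔
        r ∈ Set.Ioo (0 : ℝ) 1 ∧ Real.cos θ ∈ B := by
      simp only [Set.mem_ofPred_eq, hn, B, C, smul_smul, inv_mul_cancel₀ hr'.ne', one_smul]
    rw [ENNReal.ofReal_mul (by positivity)]
    clear_value B C
    by_cases h1 : r ∈ Set.Ioo (0 : ℝ) 1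
    · by_cases h2 : Real.cos θ ∈ B
      · rw [Set.indicator_of_mem (hmem.2 ⟨h1, h2⟩), Set.indicator_of_mem h1,
          Set.indicator_of_mem h2]
        simp [mul_comm]
      · rw [Set.indicator_of_notMem (fun h => h2 (hmem.1 h).2), Set.indicator_of_notMem h2]
        simp
    · rw [Set.indicator_of_notMem (fun h => h1 (hmem.1 h).1), Set.indicator_of_notMem h1]
      simp
  rw [setLIntegral_congr_fun measurableSet_Ioi hr, lintegral_const_mul' _ _ (by
    refine ENNReal.mul_ne_top (by simp) ?_
    by_cases h : Real.cos θ ∈ B <;> simp [h])]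
  have hint : ∫⁻ r in Set.Ioi (0 : ℝ),
      (Set.Ioo (0 : ℝ) 1).indicator (fun r => ENNReal.ofReal (r ^ 2)) r = ENNReal.ofReal (1 / 3) := by
    rw [lintegral_indicator measurableSet_Ioo, Measure.restrict_restrict measurableSet_Ioo,
      Set.inter_eq_left.2 (fun x hx => hx.1), ← ofReal_integral_eq_lintegral_ofReal]
    · rw [← integral_Ioc_eq_integral_Ioo, ← intervalIntegral.integral_of_le zero_le_one]
      norm_num
    · exact ((continuous_pow 2).integrableOn_Icc (a := (0 : ℝ)) (b := 1)).mono_set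
        Set.Ioo_subset_Icc_self
    · exact Filter.Eventually.of_forall fun r => sq_nonneg r
  rw [hint, mul_comm, mul_assoc]
  have h3 : ENNReal.ofReal (1 / 3) * (Module.finrank ℝ E3 : ℝ≥0∞) = 1 := by
    rw [finrank_euclideanSpace_fin, show ((3 : ℕ) : ℝ≥0∞) = ENNReal.ofReal 3 by simp,
      ← ENNReal.ofReal_mul (by norm_num)]
    norm_num
  rw [h3, mul_one]

/-! ### The scattered cosine as a function of the incidence. -/

/-- The cosine of the angle of incidence on the unit ball at distance `d` from the source, for a
direction that makes an angle with cosine `c` with the axis. -/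
def incidence (d c : ℝ) : ℝ := √(1 - d ^ 2 * (1 - c ^ 2))

/-- The cosine of the angle between the axis and the scattered direction. -/
def scatterCos (d c : ℝ) : ℝ :=
  c * (1 - 2 * incidence d c ^ 2) - 2 * incidence d c * d * (1 - c ^ 2)

/-- The inverse function of `incidence d`. -/
def sourceCos (d s : ℝ) : ℝ := √(1 - (1 - s ^ 2) / d ^ 2)

/-- The scattered direction as a function of the cosine of the angle of incidence. -/
def scatterProfile (d s : ℝ) : ℝ := (1 - 2 * s ^ 2) * sourceCos d s - 2 * s * (1 - s ^ 2) / d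

/-- The derivative of `scatterProfile`. -/
def scatterProfileDeriv (d s : ℝ) : ℝ :=
  -4 * s * sourceCos d s + (1 - 2 * s ^ 2) * (s / (d ^ 2 * sourceCos d s)) - (2 - 6 * s ^ 2) / d

section
variable {d s : ℝ}

lemma sourceCos_arg_pos (hd : 1 < d) : 0 < 1 - (1 - s ^ 2) / d ^ 2 := by
  have : (1 - s ^ 2) / d ^ 2 < 1 := by
    rw [div_lt_one (by positivity)]; nlinarith [sq_nonneg s]
  linarith

lemma sourceCos_pos (hd : 1 < d) : 0 < sourceCos d s := Real.sqrt_pos.2 (sourceCos_arg_pos hd)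

lemma sourceCos_sq (hd : 1 < d) : d ^ 2 * (1 - sourceCos d s ^ 2) = 1 - s ^ 2 := by
  rw [sourceCos, Real.sq_sqrt (sourceCos_arg_pos hd).le]
  field_simp
  ring

lemma incidence_sourceCos (hd : 1 < d) (hs : 0 ≤ s) : incidence d (sourceCos d s) = s := by
  rw [incidence, sourceCos_sq hd, sub_sub_cancel, Real.sqrt_sq hs]

lemma scatterCos_sourceCos (hd : 1 < d) (hs : 0 ≤ s) :
    scatterCos d (sourceCos d s) = scatterProfile d s := by
  rw [scatterCos, incidence_sourceCos hd hs, scatterProfile, ← sourceCos_sq hd (s := s)]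
  field_simp

lemma hasDerivAt_sourceCos (hd : 1 < d) :
    HasDerivAt (sourceCos d) (s / (d ^ 2 * sourceCos d s)) s := by
  have h1 : HasDerivAt (fun s : ℝ => 1 - (1 - s ^ 2) / d ^ 2) (2 * s / d ^ 2) s := by
    have := (((hasDerivAt_pow 2 s).const_sub 1).div_const (d ^ 2)).const_sub 1
    refine this.congr_deriv ?_
    simp
    ring
  refine (h1.sqrt (sourceCos_arg_pos hd).ne').congr_deriv ?_
  change _ / (2 * sourceCos d s) = _
  have := (sourceCos_pos hd (s := s)).ne'
  field_simp

lemma hasDerivAt_scatterProfile (hd : 1 < d) :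
    HasDerivAt (scatterProfile d) (scatterProfileDeriv d s) s := by
  have h1 : HasDerivAt (fun s : ℝ => 1 - 2 * s ^ 2) (-4 * s) s :=
    (((hasDerivAt_pow 2 s).const_mul 2).const_sub 1).congr_deriv (by simp; ring)
  have h2 : HasDerivAt (fun s : ℝ => 2 * s * (1 - s ^ 2) / d) ((2 - 6 * s ^ 2) / d) s := by
    refine ((((hasDerivAt_id s).const_mul 2).mul
      ((hasDerivAt_pow 2 s).const_sub 1)).div_const d).congr_deriv ?_
    simp
    ring
  exact ((h1.mul (hasDerivAt_sourceCos hd)).sub h2).congr_deriv rfl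

lemma strictMonoOn_sourceCos (hd : 1 < d) : StrictMonoOn (sourceCos d) (Set.Ici 0) := by
  intro x hx y hy hxy
  refine Real.sqrt_lt_sqrt (sourceCos_arg_pos hd).le ?_
  have hx' : 0 ≤ x := hx
  gcongr

lemma sourceCos_one : sourceCos d 1 = 1 := by simp [sourceCos]

lemma sourceCos_mem (hd : 1 < d) (hs : s ∈ Set.Ioo (0 : ℝ) 1) :
    sourceCos d s ∈ Set.Ioo (sourceCos d 0) 1 :=
  ⟨strictMonoOn_sourceCos hd Set.self_mem_Ici hs.1.le hs.1,
    (strictMonoOn_sourceCos hd hs.1.le (Set.mem_Ici.2 zero_le_one) hs.2).trans_eq sourceCos_one⟩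

/-- The square root of a number in [0, 1] is at least that number. -/
lemma sourceCos_zero_ge (hd : 1 < d) : 1 - 1 / d ^ 2 ≤ sourceCos d 0 := by
  have h := sourceCos_arg_pos hd (s := 0)
  have h1 : sourceCos d 0 ^ 2 = 1 - 1 / d ^ 2 := by
    rw [sourceCos, Real.sq_sqrt h.le]; simp
  have h2 : sourceCos d 0 ≤ 1 := by
    rw [← sourceCos_one (d := d)]
    exact ((strictMonoOn_sourceCos hd) Set.self_mem_Ici (Set.mem_Ici.2 zero_le_one) one_pos).le
  nlinarith [sourceCos_pos hd (s := 0)]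

lemma image_sourceCos (hd : 1 < d) :
    sourceCos d '' Set.Ioo 0 1 = Set.Ioo (sourceCos d 0) 1 := by
  refine Set.Subset.antisymm ?_ ?_
  · rintro _ ⟨s, hs, rfl⟩; exact sourceCos_mem hd hs
  · have := intermediate_value_Ioo zero_le_one (f := sourceCos d)
      (fun s _ => (hasDerivAt_sourceCos hd).continuousAt.continuousWithinAt)
    rwa [sourceCos_one] at this

/-- The solid angle of the ball, as a fraction of the sphere. -/
def capFraction (d : ℝ) : ℝ := (1 - sourceCos d 0) / 2

lemma capFraction_pos (hd : 1 < d) : 0 < capFraction d := by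
  have := (strictMonoOn_sourceCos hd) Set.self_mem_Ici (Set.mem_Ici.2 zero_le_one) one_pos
  rw [sourceCos_one] at this
  unfold capFraction; linarith

/-- For a distant ball the scattering is almost isotropic. -/
lemma abs_density_sub_le (hd : 3 ≤ d) (hs : s ∈ Set.Ioo (0 : ℝ) 1) :
    |s / (d ^ 2 * sourceCos d s) - capFraction d * (-scatterProfileDeriv d s)| ≤
      capFraction d * (9 / d) := by
  have hd1 : 1 < d := by linarith
  have hκ := capFraction_pos hd1
  obtain ⟨h1, h2⟩ := sourceCos_mem hd1 hs
  have h0 := sourceCos_zero_ge hd1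
  have h00 : d ^ 2 * (1 - sourceCos d 0 ^ 2) = 1 := by simpa using sourceCos_sq hd1 (s := 0)
  unfold scatterProfileDeriv
  set C := sourceCos d s
  set c0 := sourceCos d 0 with hc0
  set κ := capFraction d with hκd
  have hκ2 : 1 - c0 = 2 * κ := by rw [hκd, capFraction]; ring
  obtain ⟨ε, hε⟩ : ∃ ε, ε = 1 / d := ⟨_, rfl⟩
  have hεd : ε * d = 1 := by rw [hε]; field_simp
  have hε0 : 0 < ε := by rw [hε]; positivity
  have hε3 : ε ≤ 1 / 3 := by nlinarith
  have e2 : 1 / d ^ 2 = ε ^ 2 := by rw [hε]; field_simp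
  rw [e2] at h0
  have hε9 : ε ^ 2 ≤ ε / 3 := by nlinarith
  have hC : 0 < C := by nlinarith
  have hc09 : 8 / 9 ≤ c0 := by nlinarith
  have e3 : s / (d ^ 2 * C) = ε ^ 2 * (s / C) := by rw [← e2]; field_simp
  -- This exact form of κ ≈ ε²/4 comes from 1 - c0² = 1/d² and 1 - c0 = 2κ. It lets κ be factored
  -- out of the whole difference.
  have e4 : ε ^ 2 = κ * (2 * (1 + c0)) := by
    have : ε ^ 2 * d ^ 2 = 1 := by rw [← mul_pow, hεd, one_pow]
    have h5 : d ^ 2 * (κ * (2 * (1 + c0))) = 1 := by 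
      linear_combination h00 - d ^ 2 * (1 + c0) * hκ2
    have hdd : d ^ 2 ≠ 0 := by positivity
    apply mul_left_cancel₀ hdd
    linarith
  have hsC : s / C ≤ 9 / 8 := by
    rw [div_le_iff₀ hC]; nlinarith [hs.2]
  have hsC0 : 0 < s / C := div_pos hs.1 hC
  have e5 : s / (d ^ 2 * C) - κ * -(-4 * s * C + (1 - 2 * s ^ 2) * (s / (d ^ 2 * C)) -
      (2 - 6 * s ^ 2) / d) = κ * (2 * (s / C) * (1 + c0 - 2 * C ^ 2) +
        (1 - 2 * s ^ 2) * (ε ^ 2 * (s / C)) - (2 - 6 * s ^ 2) * ε) := by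
    have e6 : s * C = (s / C) * C ^ 2 := by field_simp
    have e7 : (2 - 6 * s ^ 2) / d = (2 - 6 * s ^ 2) * ε := by rw [hε]; ring
    rw [e7, e3]
    have : -4 * s * C = -4 * ((s / C) * C ^ 2) := by rw [← e6]; ring
    rw [this]
    linear_combination (s / C) * e4
  rw [e5, abs_mul, abs_of_pos hκ]
  refine mul_le_mul_of_nonneg_left ?_ hκ.le
  have e8 : 9 / d = 9 * ε := by rw [hε]; ring
  rw [e8]
  have hs2 : s ^ 2 ≤ 1 := pow_le_one₀ hs.1.le hs.2.le
  have hs2' : 0 ≤ s ^ 2 := sq_nonneg s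
  have hC2 : C ^ 2 ≤ 1 := pow_le_one₀ hC.le h2.le
  have hC3 : c0 ^ 2 ≤ C ^ 2 := pow_le_pow_left₀ (by linarith) h1.le 2
  have hc1 : (1 - c0) * (1 + 2 * c0) ≤ ε ^ 2 * 3 :=
    mul_le_mul (by linarith) (by linarith) (by linarith) (by positivity)
  -- The leading terms cancel to order ε² because c0 and C are both within O(ε²) of 1; only `b3` is
  -- of order ε.
  have b1 : |2 * (s / C) * (1 + c0 - 2 * C ^ 2)| ≤ 9 / 4 * (3 * ε ^ 2) := by
    rw [abs_mul, abs_of_pos (by positivity)]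
    refine mul_le_mul (by linarith) ?_ (abs_nonneg _) (by norm_num)
    rw [abs_le]; constructor <;> linarith
  have b2 : |(1 - 2 * s ^ 2) * (ε ^ 2 * (s / C))| ≤ 1 * (ε ^ 2 * (9 / 8)) := by
    rw [abs_mul, abs_of_pos (show 0 < ε ^ 2 * (s / C) by positivity)]
    refine mul_le_mul ?_ (by gcongr) (by positivity) (by norm_num)
    rw [abs_le]; constructor <;> linarith
  have b3 : |(2 - 6 * s ^ 2) * ε| ≤ 4 * ε := by
    rw [abs_mul, abs_of_pos hε0]
    refine mul_le_mul_of_nonneg_right ?_ hε0.le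
    rw [abs_le]; constructor <;> linarith
  calc _ ≤ |2 * (s / C) * (1 + c0 - 2 * C ^ 2)| + |(1 - 2 * s ^ 2) * (ε ^ 2 * (s / C))| +
        |(2 - 6 * s ^ 2) * ε| := (abs_sub _ _).trans (by gcongr; exact abs_add_le _ _)
    _ ≤ _ := by linarith

/-- The term -4sC, with C ≥ 8/9, outweighs the positive terms, which are at most s/8 and 2s when d ≥
3. Monotonicity in s makes the change of variables to the scattered cosine legitimate. -/
lemma scatterProfileDeriv_neg (hd : 3 ≤ d) (hs : s ∈ Set.Ioo (0 : ℝ) 1) :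
    scatterProfileDeriv d s < 0 := by
  have hd1 : 1 < d := by linarith
  obtain ⟨h1, h2⟩ := sourceCos_mem hd1 hs
  have h0 := sourceCos_zero_ge hd1
  unfold scatterProfileDeriv
  set C := sourceCos d s
  obtain ⟨ε, hε⟩ : ∃ ε, ε = 1 / d := ⟨_, rfl⟩
  have hεd : ε * d = 1 := by rw [hε]; field_simp
  have hε0 : 0 < ε := by rw [hε]; positivity
  have hε3 : ε ≤ 1 / 3 := by nlinarith
  have e2 : 1 / d ^ 2 = ε ^ 2 := by rw [hε]; field_simp
  rw [e2] at h0
  have hC9 : 8 / 9 ≤ C := by nlinarith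
  have hC : 0 < C := by linarith
  have e3 : s / (d ^ 2 * C) = ε ^ 2 * (s / C) := by rw [← e2]; field_simp
  have e7 : (2 - 6 * s ^ 2) / d = (2 - 6 * s ^ 2) * ε := by rw [hε]; ring
  have hsC : s / C ≤ 9 / 8 * s := by
    rw [div_le_iff₀ hC]; nlinarith [hs.1]
  have hsC0 : 0 < s / C := div_pos hs.1 hC
  rw [e3, e7]
  have b1 : (1 - 2 * s ^ 2) * (ε ^ 2 * (s / C)) ≤ 1 * (1 / 9 * (9 / 8 * s)) := by
    refine mul_le_mul (by nlinarith) ?_ (by positivity) (by norm_num)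
    exact mul_le_mul (by nlinarith) hsC hsC0.le (by norm_num)
  have b2 : 6 * s ^ 2 * ε ≤ 2 * s := by
    have : s ^ 2 * ε ≤ s * (1 / 3) := mul_le_mul (by nlinarith [hs.1, hs.2]) hε3 hε0.le hs.1.le
    linarith
  nlinarith [hs.1]

lemma strictAntiOn_scatterProfile (hd : 3 ≤ d) :
    StrictAntiOn (scatterProfile d) (Set.Icc 0 1) := by
  have hd1 : 1 < d := by linarith
  refine strictAntiOn_of_deriv_neg (convex_Icc 0 1)
    (fun s _ => (hasDerivAt_scatterProfile hd1).continuousAt.continuousWithinAt) fun s hs => ?_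
  rw [interior_Icc] at hs
  rw [(hasDerivAt_scatterProfile hd1).deriv]
  exact scatterProfileDeriv_neg hd hs

/-- Grazing incidence s = 0 leaves the direction undeflected and head-on incidence s = 1 reverses
it. The only cosines missed, up to endpoints, are those in the shadow of the ball. -/
lemma image_scatterProfile (hd : 3 ≤ d) :
    scatterProfile d '' Set.Ioo 0 1 = Set.Ioo (-1) (sourceCos d 0) := by
  have hd1 : 1 < d := by linarith
  have h0 : scatterProfile d 0 = sourceCos d 0 := by simp [scatterProfile]
  have h1 : scatterProfile d 1 = -1 := by
    rw [scatterProfile, sourceCos_one]; norm_num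
  have ha := strictAntiOn_scatterProfile hd
  refine Set.Subset.antisymm ?_ ?_
  · rintro _ ⟨s, hs, rfl⟩
    refine ⟨?_, ?_⟩
    · rw [← h1]; exact ha ⟨hs.1.le, hs.2.le⟩ ⟨zero_le_one, le_rfl⟩ hs.2
    · rw [← h0]; exact ha ⟨le_rfl, zero_le_one⟩ ⟨hs.1.le, hs.2.le⟩ hs.1
  · have := intermediate_value_Ioo' zero_le_one (f := scatterProfile d)
      (fun s _ => (hasDerivAt_scatterProfile hd1).continuousAt.continuousWithinAt)
    rwa [h0, h1] at this

end

/-! ### Comparison of the law of the scattered cosine with Lebesgue measure. -/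

lemma measurable_incidence (d : ℝ) : Measurable (incidence d) := by
  unfold incidence; fun_prop

lemma measurable_scatterCos (d : ℝ) : Measurable (scatterCos d) := by
  have := measurable_incidence d
  unfold scatterCos; fun_prop

lemma volume_scatterCos_preimage {d : ℝ} (hd : 1 < d) {B : Set ℝ} (hB : MeasurableSet B) :
    volume (Set.Ioo (sourceCos d 0) 1 ∩ scatterCos d ⁻¹' B) =
      ∫⁻ s in Set.Ioo (0 : ℝ) 1, ENNReal.ofReal (s / (d ^ 2 * sourceCos d s)) *
        B.indicator 1 (scatterProfile d s) := by
  have hB' := measurable_scatterCos d hB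
  have key := lintegral_image_eq_lintegral_deriv_mul_of_monotoneOn
    (s := Set.Ioo (0 : ℝ) 1) measurableSet_Ioo
    (fun x _ => (hasDerivAt_sourceCos hd).hasDerivWithinAt)
    ((strictMonoOn_sourceCos hd).monotoneOn.mono fun x hx => hx.1.le)
    ((scatterCos d ⁻¹' B).indicator 1)
  rw [image_sourceCos hd, lintegral_indicator_one hB', Measure.restrict_apply hB',
    Set.inter_comm] at key
  rw [key]
  refine setLIntegral_congr_fun measurableSet_Ioo fun s hs => ?_
  have h := scatterCos_sourceCos hd hs.1.le
  by_cases hm : scatterProfile d s ∈ B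
  · rw [Set.indicator_of_mem hm, Set.indicator_of_mem (by rwa [Set.mem_preimage, h])]
    simp
  · rw [Set.indicator_of_notMem hm, Set.indicator_of_notMem (by rwa [Set.mem_preimage, h])]

lemma volume_inter_image {d : ℝ} (hd : 3 ≤ d) {B : Set ℝ} (hB : MeasurableSet B) :
    volume (Set.Ioo (-1) (sourceCos d 0) ∩ B) =
      ∫⁻ s in Set.Ioo (0 : ℝ) 1, ENNReal.ofReal (-scatterProfileDeriv d s) *
        B.indicator 1 (scatterProfile d s) := by
  have key := lintegral_image_eq_lintegral_deriv_mul_of_antitoneOn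
    (s := Set.Ioo (0 : ℝ) 1) measurableSet_Ioo
    (fun x _ => (hasDerivAt_scatterProfile (by linarith)).hasDerivWithinAt)
    ((strictAntiOn_scatterProfile hd).antitoneOn.mono Set.Ioo_subset_Icc_self)
    (B.indicator 1)
  rw [image_scatterProfile hd, lintegral_indicator_one hB, Measure.restrict_apply hB,
    Set.inter_comm] at key
  exact key

lemma volume_scatterCos_preimage_le {d : ℝ} (hd : 3 ≤ d) {B : Set ℝ} (hB : MeasurableSet B) :
    volume (Set.Ioo (sourceCos d 0) 1 ∩ scatterCos d ⁻¹' B) ≤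
      ENNReal.ofReal (capFraction d) * (volume (Set.Ioo (-1) 1 ∩ B) + ENNReal.ofReal (10 / d)) := by
  have hd1 : 1 < d := by linarith
  have hκ := capFraction_pos hd1
  have hsub : volume (Set.Ioo (-1) (sourceCos d 0) ∩ B) ≤ volume (Set.Ioo (-1) 1 ∩ B) :=
    measure_mono (Set.inter_subset_inter_left _ (Set.Ioo_subset_Ioo_right (by
      unfold capFraction at hκ; linarith)))
  refine le_trans ?_ (mul_le_mul_right (add_le_add_left hsub _) _)
  rw [volume_scatterCos_preimage hd1 hB, volume_inter_image hd hB]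
  have hc : ENNReal.ofReal (10 / d) = ∫⁻ _ in Set.Ioo (0 : ℝ) 1, ENNReal.ofReal (10 / d) := by
    simp
  rw [hc, ← lintegral_add_right _ measurable_const, ← lintegral_const_mul' _ _ (by simp)]
  refine setLIntegral_mono' measurableSet_Ioo fun s hs => ?_
  by_cases hm : scatterProfile d s ∈ B
  · have h1 := scatterProfileDeriv_neg hd hs
    rw [Set.indicator_of_mem hm, Pi.one_apply, mul_one, mul_one,
      ← ENNReal.ofReal_add (by linarith) (by positivity), ← ENNReal.ofReal_mul hκ.le]
    refine ENNReal.ofReal_le_ofReal ?_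
    have := (abs_le.1 (abs_density_sub_le hd hs)).2
    have : capFraction d * (9 / d) ≤ capFraction d * (10 / d) := by gcongr; norm_num
    linarith
  · rw [Set.indicator_of_notMem hm]; simp

lemma le_volume_scatterCos_preimage {d : ℝ} (hd : 3 ≤ d) {B : Set ℝ} (hB : MeasurableSet B) :
    ENNReal.ofReal (capFraction d) * volume (Set.Ioo (-1) 1 ∩ B) ≤
      volume (Set.Ioo (sourceCos d 0) 1 ∩ scatterCos d ⁻¹' B) +
        ENNReal.ofReal (capFraction d) * ENNReal.ofReal (10 / d) := by
  have hd1 : 1 < d := by linarith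
  have hκ := capFraction_pos hd1
  -- The shadow has length at most 1/d² ≤ 1/d. Together with the 9/d of the density estimate this
  -- makes up 10/d.
  have hsub : volume (Set.Ioo (-1) 1 ∩ B) ≤
      volume (Set.Ioo (-1) (sourceCos d 0) ∩ B) + ENNReal.ofReal (1 / d) := by
    have h1 : volume (Set.Ico (sourceCos d 0) 1) ≤ ENNReal.ofReal (1 / d) := by
      rw [Real.volume_Ico]
      refine ENNReal.ofReal_le_ofReal ?_
      have h2 := sourceCos_zero_ge hd1
      have h3 : 1 / d ^ 2 ≤ 1 / d := by
        apply one_div_le_one_div_of_le (by linarith); nlinarith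
      linarith
    refine le_trans (measure_mono ?_) ((measure_union_le _ _).trans (add_le_add_right h1 _))
    rintro x ⟨hx, hxB⟩
    rcases lt_or_ge x (sourceCos d 0) with h | h
    · exact Or.inl ⟨⟨hx.1, h⟩, hxB⟩
    · exact Or.inr ⟨h, hx.2⟩
  refine (mul_le_mul_right hsub _).trans ?_
  rw [mul_add]
  have h10 : ENNReal.ofReal (10 / d) = ENNReal.ofReal (9 / d) + ENNReal.ofReal (1 / d) := by
    rw [← ENNReal.ofReal_add (by positivity) (by positivity)]
    congr 1; ring
  rw [h10, mul_add, ← add_assoc]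
  refine add_le_add_left ?_ _
  rw [volume_scatterCos_preimage hd1 hB, volume_inter_image hd hB]
  have hc : ENNReal.ofReal (9 / d) = ∫⁻ _ in Set.Ioo (0 : ℝ) 1, ENNReal.ofReal (9 / d) := by
    simp
  rw [hc, ← lintegral_const_mul' _ _ (by simp), ← lintegral_const_mul' _ _ (by simp),
    ← lintegral_add_right _ measurable_const]
  refine setLIntegral_mono' measurableSet_Ioo fun s hs => ?_
  by_cases hm : scatterProfile d s ∈ B
  · have h1 := scatterProfileDeriv_neg hd hs
    have hC := sourceCos_pos hd1 (s := s)
    have h2 : 0 ≤ s / (d ^ 2 * sourceCos d s) := by have := hs.1.le; positivity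
    rw [Set.indicator_of_mem hm, Pi.one_apply, mul_one, mul_one,
      ← ENNReal.ofReal_mul hκ.le, ← ENNReal.ofReal_mul hκ.le,
      ← ENNReal.ofReal_add h2 (by positivity)]
    refine ENNReal.ofReal_le_ofReal ?_
    have := (abs_le.1 (abs_density_sub_le hd hs)).1
    linarith
  · rw [Set.indicator_of_notMem hm]; simp

/-! ### Scattering on the sphere and its near isotropy. -/

/-- The direction into which a particle with direction `v` is scattered by a unit ball whose centre
lies at distance `d` in direction `z` from the source. -/
def scatter (d : ℝ) (z v : E3) : E3 :=
  (1 + 2 * incidence d ⟪v, z⟫ * (d * ⟪v, z⟫ - incidence d ⟪v, z⟫)) • v -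
    (2 * incidence d ⟪v, z⟫ * d) • z

lemma measurable_scatter (d : ℝ) (z : E3) : Measurable (scatter d z) := by
  have := measurable_incidence d
  unfold scatter; fun_prop

lemma incidence_sq {d c : ℝ} (hd : 1 < d) (hc : sourceCos d 0 < c) :
    0 < 1 - d ^ 2 * (1 - c ^ 2) ∧ incidence d c ^ 2 = 1 - d ^ 2 * (1 - c ^ 2) ∧
      0 < incidence d c ∧ incidence d c < d * c := by
  have h0 := sourceCos_pos hd (s := 0)
  have h00 : d ^ 2 * (1 - sourceCos d 0 ^ 2) = 1 := by simpa using sourceCos_sq hd (s := 0)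
  have hcc : sourceCos d 0 ^ 2 < c ^ 2 := pow_lt_pow_left₀ hc h0.le two_ne_zero
  have hpos : 0 < 1 - d ^ 2 * (1 - c ^ 2) := by
    have : 0 < d ^ 2 := by positivity
    nlinarith
  have hs : incidence d c ^ 2 = 1 - d ^ 2 * (1 - c ^ 2) := Real.sq_sqrt hpos.le
  refine ⟨hpos, hs, Real.sqrt_pos.2 hpos, ?_⟩
  have hc0 : 0 < c := h0.trans hc
  refine lt_of_pow_lt_pow_left₀ 2 (by positivity) ?_
  rw [hs]; nlinarith

/-- Only the `v` term of `scatter` has a component orthogonal to the axis, so that component is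
multiplied by the coefficient of `v`. -/
lemma one_sub_scatterCos_sq {d c : ℝ} (hd : 1 < d) (hc : sourceCos d 0 < c) :
    1 - scatterCos d c ^ 2 =
      (1 + 2 * incidence d c * (d * c - incidence d c)) ^ 2 * (1 - c ^ 2) := by
  obtain ⟨-, hs, -, -⟩ := incidence_sq hd hc
  rw [scatterCos]
  set σ := incidence d c
  linear_combination (-4 * σ ^ 2) * hs

/-- Reflection stays in the plane of the axis and `v`, and the coefficient of `v` is positive, so
the azimuth does not jump by π. -/
lemma scatter_spherePoint (b : OrthonormalBasis (Fin 3) ℝ E3) {d c : ℝ} (φ : ℝ) (hd : 1 < d)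
    (hc : sourceCos d 0 < c) :
    scatter d (b 0) (spherePoint b c φ) = spherePoint b (scatterCos d c) φ := by
  obtain ⟨-, hs, h1, h2⟩ := incidence_sq hd hc
  have hc0 : 0 < c := (sourceCos_pos hd).trans hc
  rw [scatter, inner_spherePoint, spherePoint, spherePoint, one_sub_scatterCos_sq hd hc,
    Real.sqrt_mul (sq_nonneg _), Real.sqrt_sq (by nlinarith), smul_add, smul_smul, smul_smul,
    add_sub_right_comm, ← sub_smul]
  congr 2
  rw [scatterCos]
  ring

lemma exists_orthonormalBasis {z : E3} (hz : ‖z‖ = 1) :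
    ∃ b : OrthonormalBasis (Fin 3) ℝ E3, b 0 = z := by
  have : Orthonormal ℝ (({0} : Set (Fin 3)).domRestrict fun _ => z) := by
    rw [orthonormal_iff_ite]
    rintro ⟨i, hi⟩ ⟨j, hj⟩
    have hij : i = j := by
      rw [Set.mem_singleton_iff] at hi hj; rw [hi, hj]
    simp [hij, hz]
  obtain ⟨b, hb⟩ := this.exists_orthonormalBasis_extension_of_card_eq (by simp)
  exact ⟨b, hb 0 rfl⟩

lemma spherePoint_mem_image (b : OrthonormalBasis (Fin 3) ℝ E3) {c φ : ℝ}
    (hc : c ∈ Set.Ioo (-1 : ℝ) 1) {p : E3 → Prop} :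
    spherePoint b c φ ∈ ((↑) '' {v : S2 | p v} : Set E3) ↔ p (spherePoint b c φ) := by
  constructor
  · rintro ⟨v, hv, h⟩; rw [← h]; exact hv
  · intro h
    exact ⟨⟨spherePoint b c φ, by simpa using norm_spherePoint b hc φ⟩, h, rfl⟩

lemma measurableSet_coe_image {A : Set S2} (hA : MeasurableSet A) :
    MeasurableSet ((↑) '' A : Set E3) :=
  (MeasurableEmbedding.subtype_coe isClosed_sphere.measurableSet).measurableSet_image.2 hA

lemma volume_azimuth : volume (Set.Ioo (-Real.pi) Real.pi) = ENNReal.ofReal (2 * Real.pi) := by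
  rw [Real.volume_Ioo]; congr 1; ring

/-- The area of a spherical cap. -/
lemma surface_cap {z : E3} (hz : ‖z‖ = 1) {x : ℝ} (hx : -1 ≤ x) :
    surface {v : S2 | x < ⟪(v : E3), z⟫} = ENNReal.ofReal (1 - x) * ENNReal.ofReal (2 * Real.pi) := by
  obtain ⟨b, rfl⟩ := exists_orthonormalBasis hz
  rw [surface_eq_lintegral b (measurableSet_lt measurable_const (by fun_prop)), ← volume_azimuth,
    ← setLIntegral_const]
  refine setLIntegral_congr_fun measurableSet_Ioo fun φ _ => ?_
  rw [← Real.volume_Ioo]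
  congr 1
  ext c
  constructor
  · rintro ⟨hc, h⟩
    have := (spherePoint_mem_image b hc (p := fun v => x < ⟪v, b 0⟫)).1 h
    rw [inner_spherePoint] at this
    exact ⟨this, hc.2⟩
  · rintro ⟨h1, h2⟩
    have hc : c ∈ Set.Ioo (-1 : ℝ) 1 := ⟨hx.trans_lt h1, h2⟩
    refine ⟨hc, (spherePoint_mem_image b hc (p := fun v => x < ⟪v, b 0⟫)).2 ?_⟩
    rwa [inner_spherePoint]

lemma surface_univ : surface Set.univ = ENNReal.ofReal (4 * Real.pi) := by
  have h := surface_eq_lintegral (EuclideanSpace.basisFun (Fin 3) ℝ) MeasurableSet.univ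
  rw [h, setLIntegral_congr_fun (g := fun _ => ENNReal.ofReal 2) measurableSet_Ioo,
    setLIntegral_const, volume_azimuth, ← ENNReal.ofReal_mul (by norm_num)]
  · congr 1; ring
  · intro φ _
    rw [show ENNReal.ofReal 2 = volume (Set.Ioo (-1 : ℝ) 1) by rw [Real.volume_Ioo]; norm_num]
    refine congrArg _ (Set.inter_eq_left.2 fun c hc => ?_)
    exact ⟨⟨spherePoint _ c φ, by simpa using norm_spherePoint _ hc φ⟩, trivial, rfl⟩

/-- The directions that hit the ball and are scattered into `A`. -/
def scatterInto (d : ℝ) (z : E3) (A : Set S2) : Set S2 :=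
  {v | sourceCos d 0 < ⟪(v : E3), z⟫ ∧ scatter d z v ∈ ((↑) '' A : Set E3)}

lemma measurableSet_scatterInto (d : ℝ) (z : E3) {A : Set S2} (hA : MeasurableSet A) :
    MeasurableSet (scatterInto d z A) :=
  (measurableSet_lt (f := fun _ : S2 => sourceCos d 0) (g := fun v : S2 => ⟪(v : E3), z⟫)
    measurable_const (by fun_prop)).inter (((measurable_scatter d z).comp measurable_subtype_coe) (measurableSet_coe_image hA))

lemma surface_scatterInto (b : OrthonormalBasis (Fin 3) ℝ E3) {d : ℝ} (hd : 1 < d) {A : Set S2}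
    (hA : MeasurableSet A) :
    surface (scatterInto d (b 0) A) = ∫⁻ φ in Set.Ioo (-Real.pi) Real.pi,
      volume (Set.Ioo (sourceCos d 0) 1 ∩
        scatterCos d ⁻¹' {c | spherePoint b c φ ∈ ((↑) '' A : Set E3)}) := by
  rw [surface_eq_lintegral b (measurableSet_scatterInto d _ hA)]
  refine setLIntegral_congr_fun measurableSet_Ioo fun φ _ => congrArg _ ?_
  ext c
  constructor
  · rintro ⟨hc, h⟩
    obtain ⟨h1, h2⟩ := (spherePoint_mem_image b hc
      (p := fun v => sourceCos d 0 < ⟪v, b 0⟫ ∧ scatter d (b 0) v ∈ ((↑) '' A : Set E3))).1 h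
    rw [inner_spherePoint] at h1
    rw [scatter_spherePoint b φ hd h1] at h2
    exact ⟨⟨h1, hc.2⟩, h2⟩
  · rintro ⟨⟨h1, h2⟩, h3⟩
    have hc : c ∈ Set.Ioo (-1 : ℝ) 1 := ⟨by linarith [sourceCos_pos hd (s := 0)], h2⟩
    refine ⟨hc, (spherePoint_mem_image b hc
      (p := fun v => sourceCos d 0 < ⟪v, b 0⟫ ∧ scatter d (b 0) v ∈ ((↑) '' A : Set E3))).2 ?_⟩
    rw [inner_spherePoint, scatter_spherePoint b φ hd h1]
    exact ⟨h1, h3⟩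

lemma measurableSet_section (b : OrthonormalBasis (Fin 3) ℝ E3) {A : Set S2}
    (hA : MeasurableSet A) (φ : ℝ) :
    MeasurableSet {c | spherePoint b c φ ∈ ((↑) '' A : Set E3)} :=
  ((measurable_spherePoint b).comp (measurable_id.prodMk measurable_const))
    (measurableSet_coe_image hA)

lemma surface_scatterInto_le {z : E3} (hz : ‖z‖ = 1) {d : ℝ} (hd : 3 ≤ d) {A : Set S2}
    (hA : MeasurableSet A) :
    surface (scatterInto d z A) ≤ ENNReal.ofReal (capFraction d) *
      (surface A + ENNReal.ofReal (10 / d) * ENNReal.ofReal (2 * Real.pi)) := by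
  obtain ⟨b, rfl⟩ := exists_orthonormalBasis hz
  rw [surface_scatterInto b (by linarith) hA, surface_eq_lintegral b hA, ← volume_azimuth,
    ← setLIntegral_const, ← lintegral_add_right _ measurable_const,
    ← lintegral_const_mul' _ _ (by simp)]
  exact lintegral_mono fun φ => volume_scatterCos_preimage_le hd (measurableSet_section b hA φ)

lemma le_surface_scatterInto {z : E3} (hz : ‖z‖ = 1) {d : ℝ} (hd : 3 ≤ d) {A : Set S2}
    (hA : MeasurableSet A) :
    ENNReal.ofReal (capFraction d) * surface A ≤ surface (scatterInto d z A) +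
      ENNReal.ofReal (capFraction d) * ENNReal.ofReal (10 / d) *
        ENNReal.ofReal (2 * Real.pi) := by
  obtain ⟨b, rfl⟩ := exists_orthonormalBasis hz
  rw [surface_scatterInto b (by linarith) hA, surface_eq_lintegral b hA, ← volume_azimuth,
    ← setLIntegral_const, ← lintegral_add_right _ measurable_const,
    ← lintegral_const_mul' _ _ (by simp)]
  exact lintegral_mono fun φ => le_volume_scatterCos_preimage hd (measurableSet_section b hA φ)

instance : IsFiniteMeasure surface := inferInstanceAs (IsFiniteMeasure (volume : Measure E3).toSphere)

instance : IsProbabilityMeasure uni where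
  measure_univ := by
    rw [uni, Measure.smul_apply, smul_eq_mul, surface_univ]
    exact ENNReal.inv_mul_cancel (by simp [Real.pi_pos]) ENNReal.ofReal_ne_top

lemma surface_real_univ : surface.real Set.univ = 4 * Real.pi := by
  rw [measureReal_def, surface_univ, ENNReal.toReal_ofReal (by positivity)]

lemma uni_real (A : Set S2) : uni.real A = surface.real A / (4 * Real.pi) := by
  rw [uni, measureReal_ennreal_smul_apply, ENNReal.toReal_inv, ← measureReal_def,
    surface_real_univ]
  ring

lemma uni_real_cap {z : E3} (hz : ‖z‖ = 1) {x : ℝ} (hx : -1 ≤ x) (hx1 : x ≤ 1) :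
    uni.real {v : S2 | x < ⟪(v : E3), z⟫} = (1 - x) / 2 := by
  rw [uni_real, measureReal_def, surface_cap hz hx, ENNReal.toReal_mul,
    ENNReal.toReal_ofReal (by linarith), ENNReal.toReal_ofReal (by positivity)]
  field_simp
  ring

/-- The law of the direction scattered by a distant ball is close to the uniform one in total
variation. -/
lemma abs_uni_scatterInto_sub_le {z : E3} (hz : ‖z‖ = 1) {d : ℝ} (hd : 3 ≤ d) {A : Set S2}
    (hA : MeasurableSet A) :
    |uni.real (scatterInto d z A) - capFraction d * uni.real A| ≤ capFraction d * (5 / d) := by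
  have hκ := capFraction_pos (show 1 < d by linarith)
  have h1 := ENNReal.toReal_mono (by finiteness) (surface_scatterInto_le hz hd hA)
  have h2 := ENNReal.toReal_mono (by finiteness) (le_surface_scatterInto hz hd hA)
  have hd0 : (0 : ℝ) ≤ 10 / d := by positivity
  have hp : (0 : ℝ) ≤ 2 * Real.pi := by positivity
  rw [ENNReal.toReal_mul, ENNReal.toReal_add (by finiteness) (by finiteness), ENNReal.toReal_mul,
    ENNReal.toReal_ofReal hκ.le, ENNReal.toReal_ofReal hd0, ENNReal.toReal_ofReal hp] at h1
  rw [ENNReal.toReal_mul, ENNReal.toReal_add (by finiteness) (by finiteness), ENNReal.toReal_mul,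
    ENNReal.toReal_mul, ENNReal.toReal_ofReal hκ.le, ENNReal.toReal_ofReal hd0,
    ENNReal.toReal_ofReal hp] at h2
  rw [← measureReal_def, ← measureReal_def] at h1 h2
  rw [uni_real, uni_real]
  have e : capFraction d * (5 / d) = capFraction d * (10 / d * (2 * Real.pi)) / (4 * Real.pi) := by
    field_simp; ring
  rw [e, ← mul_div_assoc, ← sub_div, abs_div, abs_of_pos (show 0 < 4 * Real.pi by positivity)]
  refine div_le_div_of_nonneg_right ?_ (by positivity)
  rw [abs_le]
  constructor <;> linarith

/-! ### Free flight and collision with one ball. -/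

@[simp] lemma norm_S2 (v : S2) : ‖(v : E3)‖ = 1 := norm_eq_of_mem_sphere v

lemma inner_self_S2 (v : S2) : ⟪(v : E3), (v : E3)⟫ = 1 := by
  rw [real_inner_self_eq_norm_sq, norm_S2, one_pow]

lemma mem_hitTimes_iff {c x w : E3} (hw : ‖w‖ = 1) {t : ℝ} :
    t ∈ hitTimes c x w ↔ 0 < t ∧ t ^ 2 + 2 * t * ⟪w, x - c⟫ + ‖x - c‖ ^ 2 < 1 := by
  have h : ‖x + t • w - c‖ ^ 2 = t ^ 2 + 2 * t * ⟪w, x - c⟫ + ‖x - c‖ ^ 2 := by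
    rw [show x + t • w - c = t • w + (x - c) by abel, norm_add_sq_real, norm_smul, mul_pow, hw,
      inner_smul_left, Real.norm_eq_abs, sq_abs]
    simp
    ring
  rw [← h, sq_lt_one_iff₀ (norm_nonneg _)]
  rfl

/-- A particle that leaves a scatterer does not meet it again. -/
lemma hitTimes_eq_empty {c x w : E3} (hw : ‖w‖ = 1) (hx : ‖x - c‖ = 1) (h : 0 ≤ ⟪w, x - c⟫) :
    hitTimes c x w = ∅ := by
  ext t
  rw [mem_hitTimes_iff hw, hx]
  simp only [Set.mem_empty_iff_false, iff_false, not_and, not_lt]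
  intro ht
  have := mul_nonneg ht.le h
  nlinarith [sq_nonneg t]

section Flight

variable {c x z v : E3} {d : ℝ}

lemma inner_source (hc : x - c = -(d • z)) (v : E3) : ⟪v, x - c⟫ = -(d * ⟪v, z⟫) := by
  rw [hc, inner_neg_right, inner_smul_right]

lemma norm_source (hz : ‖z‖ = 1) (hd : 1 < d) (hc : x - c = -(d • z)) : ‖x - c‖ = d := by
  rw [hc, norm_neg, norm_smul, hz, mul_one, Real.norm_of_nonneg (by linarith)]

/-- The line cuts the ball in a chord, whose endpoints are the roots of a quadratic; both are
positive since the source lies outside and in front. -/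
lemma hitTimes_eq_Ioo (hz : ‖z‖ = 1) (hv : ‖v‖ = 1) (hd : 1 < d) (hc : x - c = -(d • z))
    (h : sourceCos d 0 < ⟪v, z⟫) :
    hitTimes c x v =
      Set.Ioo (d * ⟪v, z⟫ - incidence d ⟪v, z⟫) (d * ⟪v, z⟫ + incidence d ⟪v, z⟫) := by
  obtain ⟨-, h1, h2, h3⟩ := incidence_sq hd h
  ext t
  rw [mem_hitTimes_iff hv, inner_source hc, norm_source hz hd hc]
  set C := ⟪v, z⟫
  set σ := incidence d C
  have key : t ^ 2 + 2 * t * -(d * C) + d ^ 2 - 1 = (t - d * C - σ) * (t - d * C + σ) := by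
    linear_combination h1
  constructor
  · rintro ⟨_, h5⟩
    have h6 : (t - d * C - σ) * (t - d * C + σ) < 0 := by linarith
    constructor <;> nlinarith
  · rintro ⟨h4, h5⟩
    have h6 : (t - d * C - σ) * (t - d * C + σ) < 0 :=
      mul_neg_of_neg_of_pos (by linarith) (by linarith)
    exact ⟨by linarith, by linarith⟩

lemma sourceCos_lt_of_nonempty (hz : ‖z‖ = 1) (hv : ‖v‖ = 1) (hd : 1 < d) (hc : x - c = -(d • z))
    (h : (hitTimes c x v).Nonempty) : sourceCos d 0 < ⟪v, z⟫ := by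
  obtain ⟨t, ht⟩ := h
  rw [mem_hitTimes_iff hv, inner_source hc, norm_source hz hd hc] at ht
  obtain ⟨h0, h1⟩ := ht
  set C := ⟪v, z⟫
  have h00 : d ^ 2 * (1 - sourceCos d 0 ^ 2) = 1 := by simpa using sourceCos_sq hd (s := 0)
  have hdd : 0 < d ^ 2 := by positivity
  have hC : 0 < C := by
    by_contra hC
    have h2 : t * (d * C) ≤ 0 :=
      mul_nonpos_of_nonneg_of_nonpos h0.le
        (mul_nonpos_of_nonneg_of_nonpos (by linarith) (not_lt.1 hC))
    nlinarith
  have h2 : d ^ 2 * sourceCos d 0 ^ 2 < d ^ 2 * C ^ 2 := by nlinarith [sq_nonneg (t - d * C)]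
  exact lt_of_pow_lt_pow_left₀ 2 hC.le (lt_of_mul_lt_mul_left h2 hdd.le)

/-- The point where a particle with direction `v` from `x` first meets the unit ball at distance
`d` in direction `z`. -/
def impactPoint (d : ℝ) (z x v : E3) : E3 := x + (d * ⟪v, z⟫ - incidence d ⟪v, z⟫) • v

lemma scatter_eq (hc : x - c = -(d • z)) :
    scatter d z v = v + (2 * incidence d ⟪v, z⟫) • (impactPoint d z x v - c) := by
  rw [impactPoint, add_sub_right_comm, hc, scatter]
  module

lemma inner_impactPoint (hv : ‖v‖ = 1) (hc : x - c = -(d • z)) :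
    ⟪v, impactPoint d z x v - c⟫ = -incidence d ⟪v, z⟫ := by
  rw [impactPoint, add_sub_right_comm, inner_add_right, inner_source hc, inner_smul_right,
    real_inner_self_eq_norm_sq, hv]
  ring

lemma norm_impactPoint (hz : ‖z‖ = 1) (hv : ‖v‖ = 1) (hd : 1 < d) (hc : x - c = -(d • z))
    (h : sourceCos d 0 < ⟪v, z⟫) : ‖impactPoint d z x v - c‖ = 1 := by
  obtain ⟨-, h1, -, -⟩ := incidence_sq hd h
  have h2 : ‖impactPoint d z x v - c‖ ^ 2 = 1 := by
    rw [impactPoint, add_sub_right_comm, norm_add_sq_real, norm_smul, mul_pow, hv,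
      inner_smul_right, real_inner_comm v (x - c), inner_source hc, norm_source hz hd hc,
      Real.norm_eq_abs, sq_abs]
    linear_combination h1
  exact (pow_eq_one_iff_of_nonneg (norm_nonneg _) two_ne_zero).1 h2

lemma inner_scatter_impactPoint (hz : ‖z‖ = 1) (hv : ‖v‖ = 1) (hd : 1 < d)
    (hc : x - c = -(d • z)) (h : sourceCos d 0 < ⟪v, z⟫) :
    ⟪scatter d z v, impactPoint d z x v - c⟫ = incidence d ⟪v, z⟫ := by
  rw [scatter_eq hc, inner_add_left, inner_smul_left, inner_impactPoint hv hc,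
    real_inner_self_eq_norm_sq, norm_impactPoint hz hv hd hc h]
  simp
  ring

lemma norm_scatter (hz : ‖z‖ = 1) (hv : ‖v‖ = 1) (hd : 1 < d) (h : sourceCos d 0 < ⟪v, z⟫) :
    ‖scatter d z v‖ = 1 := by
  have hc : (0 : E3) - d • z = -(d • z) := zero_sub _
  have h2 : ‖scatter d z v‖ ^ 2 = 1 := by
    rw [scatter_eq hc, norm_add_sq_real, inner_smul_right, inner_impactPoint hv hc, norm_smul,
      norm_impactPoint hz hv hd hc h, hv, Real.norm_eq_abs, mul_one, sq_abs]
    ring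
  exact (pow_eq_one_iff_of_nonneg (norm_nonneg _) two_ne_zero).1 h2

lemma collideWith_eq (hz : ‖z‖ = 1) (hv : ‖v‖ = 1) (hd : 1 < d) (hc : x - c = -(d • z))
    (h : sourceCos d 0 < ⟪v, z⟫) :
    collideWith c (x, v) = (impactPoint d z x v, scatter d z v) := by
  obtain ⟨-, -, h2, -⟩ := incidence_sq hd h
  have e : x + (d * ⟪v, z⟫ - incidence d ⟪v, z⟫) • v = impactPoint d z x v := rfl
  simp only [collideWith, hitTimes_eq_Ioo hz hv hd hc h]
  rw [csInf_Ioo (by linarith), e, reflectAt, inner_impactPoint hv hc, scatter_eq hc]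
  congr 1
  module

end Flight

/-! ### The event N = 3 as a set of velocities. -/

lemma numCollisions_eq_three_iff (e u : S2) (R : ℝ) (v : S2) :
    numCollisions e u R v = 3 ↔
      (collision e u R v 3).isSome ∧ collision e u R v 4 = none := by
  have hnone : ∀ k, 2 ≤ k → collision e u R v k = none → ∀ j, k ≤ j →
      collision e u R v j = none := by
    intro k hk h j hj
    induction j, hj using Nat.le_induction with
    | base => exact h
    | succ j hj ih =>
      -- The recursion starts only at index 3, so absence propagates only from index 2 on.
      obtain ⟨i, rfl⟩ : ∃ i, j = i + 2 := ⟨j - 2, by omega⟩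
      rw [collision, ih]; rfl
  constructor
  · intro h
    refine ⟨?_, ?_⟩
    · by_contra h3
      have h3' : collision e u R v 3 = none := by simpa using h3
      have : numCollisions e u R v ≤ 2 := by
        refine iSup₂_le fun k hk => ?_
        by_contra hk2
        have hk3 : 3 ≤ k := by
          by_contra h'
          exact hk2 (by exact_mod_cast (show k ≤ 2 by omega))
        have h0 := hnone 3 (by norm_num) h3' k hk3
        change (collision e u R v k).isSome at hk
        rw [h0] at hk
        simp at hk
      rw [h] at this
      exact absurd this (by decide)
    · by_contra h4
      have h4' : (collision e u R v 4).isSome := Option.isSome_iff_ne_none.2 h4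
      have : ((4 : ℕ) : ℕ∞) ≤ numCollisions e u R v :=
        le_iSup₂ (f := fun (k : ℕ) (_ : k ∈ {k : ℕ | (collision e u R v k).isSome}) => (k : ℕ∞))
          4 h4'
      rw [h] at this
      exact absurd this (by decide)
  · rintro ⟨h3, h4⟩
    refine le_antisymm (iSup₂_le fun k hk => ?_) ?_
    · by_contra hk3
      have hk4 : 4 ≤ k := by
        by_contra h'
        exact hk3 (by exact_mod_cast (show k ≤ 3 by omega))
      have h0 := hnone 4 (by norm_num) h4 k hk4
      change (collision e u R v k).isSome at hk
      rw [h0] at hk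
      simp at hk
    · exact le_iSup₂
        (f := fun (k : ℕ) (_ : k ∈ {k : ℕ | (collision e u R v k).isSome}) => (k : ℕ∞)) 3 h3

lemma norm_unitVector {u v : S2} (h : u ≠ v) : ‖‖(u : E3) - v‖⁻¹ • ((u : E3) - v)‖ = 1 := by
  rw [norm_smul, norm_inv, norm_norm, inv_mul_cancel₀]
  rw [norm_ne_zero_iff, sub_ne_zero]
  exact fun h' => h (Subtype.ext h')

lemma norm_sub_sq_S2 (u v : S2) : ‖(u : E3) - v‖ ^ 2 = 2 * (1 - ⟪(u : E3), (v : E3)⟫) := by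
  rw [norm_sub_sq_real, norm_S2, norm_S2]; ring

lemma inner_unitVector (u v : S2) :
    ⟪(v : E3), ‖(u : E3) - v‖⁻¹ • ((u : E3) - v)⟫ = -(‖(u : E3) - v‖ / 2) := by
  rw [inner_smul_right, inner_sub_right, inner_self_S2, real_inner_comm]
  have h := norm_sub_sq_S2 u v
  rcases eq_or_ne ‖(u : E3) - v‖ 0 with h0 | h0
  · simp [h0]
  · field_simp
    linear_combination h

section Recollision

variable (e u : S2) (R : ℝ)

/-- The distance of the first scatterer from the place of the second collision. -/
def sourceDist : ℝ := ‖R • (u : E3) - centerA e u‖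

/-- The direction of the first scatterer seen from the place of the second collision. -/
def sourceAxis : E3 := (sourceDist e u R)⁻¹ • (centerA e u - R • (u : E3))

variable {e u R}

/-- The first ball lies behind a particle leaving with velocity `u`. This gives d > 1 and d ≥ R for
every R > 0, and shows that going on with `v = u` misses the ball. -/
lemma inner_centerA_neg (h : u ≠ e) : ⟪centerA e u, (u : E3)⟫ < 0 := by
  rw [centerA, real_inner_comm, inner_unitVector]
  have : 0 < ‖(e : E3) - u‖ := norm_pos_iff.2 (sub_ne_zero.2 fun h' => h (Subtype.ext h'.symm))
  linarith

lemma sourceDist_sq (h : u ≠ e) :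
    sourceDist e u R ^ 2 = R ^ 2 - 2 * R * ⟪centerA e u, (u : E3)⟫ + 1 := by
  have h1 : ‖centerA e u‖ = 1 := norm_unitVector h.symm
  rw [sourceDist, norm_sub_sq_real, h1, norm_smul, mul_pow, norm_S2, inner_smul_left,
    real_inner_comm, Real.norm_eq_abs, sq_abs]
  simp
  ring

lemma one_lt_sourceDist (h : u ≠ e) (hR : 0 < R) : 1 < sourceDist e u R := by
  have h1 := sourceDist_sq (R := R) h
  have h2 := mul_pos hR (neg_pos.2 (inner_centerA_neg h))
  have h3 : 0 ≤ sourceDist e u R := norm_nonneg _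
  nlinarith [sq_nonneg R]

lemma le_sourceDist (h : u ≠ e) (hR : 0 < R) : R ≤ sourceDist e u R := by
  have h1 := sourceDist_sq (R := R) h
  have h2 := mul_pos hR (neg_pos.2 (inner_centerA_neg h))
  have h3 : 0 ≤ sourceDist e u R := norm_nonneg _
  nlinarith

lemma source_eq (h : u ≠ e) (hR : 0 < R) :
    R • (u : E3) - centerA e u = -(sourceDist e u R • sourceAxis e u R) := by
  have := one_lt_sourceDist h hR
  rw [sourceAxis, smul_smul, mul_inv_cancel₀ (by linarith), one_smul, neg_sub]

lemma norm_sourceAxis (h : u ≠ e) (hR : 0 < R) : ‖sourceAxis e u R‖ = 1 := by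
  have := one_lt_sourceDist h hR
  rw [sourceAxis, norm_smul, norm_inv, norm_sub_rev, ← sourceDist, Real.norm_of_nonneg (by linarith),
    inv_mul_cancel₀ (by linarith)]

lemma inner_sourceAxis_neg (h : u ≠ e) (hR : 0 < R) : ⟪(u : E3), sourceAxis e u R⟫ < 0 := by
  have h1 := one_lt_sourceDist h hR
  have h2 := inner_centerA_neg h
  rw [sourceAxis, inner_smul_right, inner_sub_right, inner_smul_right, inner_self_S2,
    real_inner_comm]
  exact mul_neg_of_pos_of_neg (inv_pos.2 (by linarith)) (by linarith)

lemma hitTimes_centerB {v : S2} (h : u ≠ v) :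
    hitTimes (centerB u R v) (R • (u : E3)) v = ∅ := by
  have e1 : R • (u : E3) - centerB u R v = -(‖(u : E3) - v‖⁻¹ • ((u : E3) - v)) := by
    rw [centerB]; abel
  refine hitTimes_eq_empty (norm_S2 v) ?_ ?_
  · rw [e1, norm_neg, norm_unitVector h]
  · rw [e1, inner_neg_right, inner_unitVector, neg_neg]; positivity

/-- The velocities `v` for which there is a fourth collision. -/
def multipleRecollision (e u : S2) (R : ℝ) : Set S2 :=
  {v | sourceCos (sourceDist e u R) 0 < ⟪(v : E3), sourceAxis e u R⟫ ∧
    (hitTimes (centerB u R v)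
      (impactPoint (sourceDist e u R) (sourceAxis e u R) (R • (u : E3)) v)
      (scatter (sourceDist e u R) (sourceAxis e u R) v)).Nonempty}

/-- The velocities `v` for which the first scatterer is hit again. -/
def hitCap (e u : S2) (R : ℝ) : Set S2 :=
  {v | sourceCos (sourceDist e u R) 0 < ⟪(v : E3), sourceAxis e u R⟫}

lemma ne_of_mem_hitCap (h : u ≠ e) (hR : 0 < R) {v : S2} (hv : v ∈ hitCap e u R) : u ≠ v := by
  rintro rfl
  have h1 := inner_sourceAxis_neg h hR
  have h2 := sourceCos_pos (one_lt_sourceDist h hR) (s := 0)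
  exact absurd (h2.trans hv) h1.not_gt

lemma collision_three_of_mem (h : u ≠ e) (hR : 0 < R) {v : S2} (hv : v ∈ hitCap e u R) :
    collision e u R v 3 =
      some (impactPoint (sourceDist e u R) (sourceAxis e u R) (R • (u : E3)) v,
        scatter (sourceDist e u R) (sourceAxis e u R) v) := by
  have hd := one_lt_sourceDist h hR
  have hz := norm_sourceAxis h hR
  have hs := source_eq h hR
  obtain ⟨-, -, h2, -⟩ := incidence_sq hd hv
  rw [collision, collision, Option.bind_some, nextCollision, if_pos, collideWith_eq hz (norm_S2 v) hd hs hv]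
  refine ⟨?_, fun t ht => ?_⟩
  swap
  · rw [hitTimes_centerB (ne_of_mem_hitCap h hR hv)] at ht; exact ht.elim
  rw [hitTimes_eq_Ioo hz (norm_S2 v) hd hs hv, Set.nonempty_Ioo]
  linarith

lemma simpleRecollision_eq (h : u ≠ e) (hR : 0 < R) :
    simpleRecollision e u R = hitCap e u R \ multipleRecollision e u R := by
  have hd := one_lt_sourceDist h hR
  have hz := norm_sourceAxis h hR
  have hs := source_eq h hR
  ext v
  rw [simpleRecollision, Set.mem_ofPred_eq, numCollisions_eq_three_iff]
  by_cases hv : v ∈ hitCap e u R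
  · have h3 := collision_three_of_mem h hR hv
    have hA : hitTimes (centerA e u)
        (impactPoint (sourceDist e u R) (sourceAxis e u R) (R • (u : E3)) v)
        (scatter (sourceDist e u R) (sourceAxis e u R) v) = ∅ := by
      refine hitTimes_eq_empty (norm_scatter hz (norm_S2 v) hd hv)
        (norm_impactPoint hz (norm_S2 v) hd hs hv) ?_
      rw [inner_scatter_impactPoint hz (norm_S2 v) hd hs hv]
      exact Real.sqrt_nonneg _
    have h4 : collision e u R v 4 = none ↔ v ∉ multipleRecollision e u R := by
      rw [collision, h3, Option.bind_some, nextCollision,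
        if_neg fun hn => Set.not_nonempty_empty (hA ▸ hn.1)]
      by_cases hB : v ∈ multipleRecollision e u R
      · rw [if_pos hB.2]; simp [hB]
      · rw [if_neg fun hn => hB ⟨hv, hn⟩]; simp [hB]
    rw [h4, h3]
    simp [hv]
  · have hA : ¬(hitTimes (centerA e u) (R • (u : E3)) v).Nonempty :=
      fun hn => hv (sourceCos_lt_of_nonempty hz (norm_S2 v) hd hs hn)
    simp only [Set.mem_sdiff, hv, false_and, iff_false]
    rintro ⟨h3, h4⟩
    rcases eq_or_ne u v with rfl | huv
    · have hB : hitTimes (centerB u R u) (R • (u : E3)) u = Set.Ioo 0 1 := by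
        ext t
        rw [mem_hitTimes_iff (norm_S2 u)]
        simp only [centerB, sub_self, smul_zero, add_zero, inner_zero_right, norm_zero, mul_zero,
          Set.mem_Ioo, and_congr_right_iff]
        intro ht
        rw [zero_pow two_ne_zero, add_zero, sq_lt_one_iff₀ ht.le]
      have hn : nextCollision (centerA e u) (centerB u R u) (R • (u : E3), (u : E3)) =
          some (R • (u : E3), (u : E3)) := by
        rw [nextCollision, if_neg fun hn => hA hn.1,
          if_pos (by rw [hB]; exact Set.nonempty_Ioo.2 one_pos)]
        simp only [collideWith, hB]
        rw [csInf_Ioo one_pos]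
        simp [reflectAt, centerB]
      simp [collision, hn] at h4
    · simp [collision, nextCollision, hA, hitTimes_centerB huv] at h3

lemma exitVelocity_eq (h : u ≠ e) (hR : 0 < R) {v : S2} (hv : v ∈ simpleRecollision e u R) :
    exitVelocity e u R v = scatter (sourceDist e u R) (sourceAxis e u R) v := by
  have h3 : numCollisions e u R v = 3 := hv
  rw [simpleRecollision_eq h hR] at hv
  rw [exitVelocity, h3, show (3 : ℕ∞).toNat = 3 from rfl, collision_three_of_mem h hR hv.1]
  rfl

end Recollision

/-! ### Measurability and positive probability of N = 3. -/

section

variable {e u : S2} {R : ℝ}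

lemma continuous_incidence (d : ℝ) : Continuous (incidence d) := by
  unfold incidence; fun_prop

lemma isOpen_hitCap : IsOpen (hitCap e u R) :=
  isOpen_lt (f := fun _ : S2 => sourceCos (sourceDist e u R) 0)
    (g := fun v : S2 => ⟪(v : E3), sourceAxis e u R⟫) continuous_const (by fun_prop)

lemma isOpen_multipleRecollision (h : u ≠ e) (hR : 0 < R) :
    IsOpen (multipleRecollision e u R) := by
  -- For each fixed time t, lying in the second ball is an open condition, as its centre is
  -- continuous in `v` away from `v = u`.
  have hU : multipleRecollision e u R = ⋃ t ∈ Set.Ioi (0 : ℝ), hitCap e u R ∩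
      (fun v : S2 => ‖impactPoint (sourceDist e u R) (sourceAxis e u R) (R • (u : E3)) v +
        t • scatter (sourceDist e u R) (sourceAxis e u R) v - centerB u R v‖) ⁻¹' Set.Iio 1 := by
    ext v
    simp only [Set.mem_iUnion, multipleRecollision, hitCap]
    constructor
    · rintro ⟨h1, t, h2, h3⟩
      exact ⟨t, h2, h1, h3⟩
    · rintro ⟨t, h2, h1, h3⟩
      exact ⟨h1, t, h2, h3⟩
  rw [hU]
  refine isOpen_biUnion fun t _ => ContinuousOn.isOpen_inter_preimage ?_ isOpen_hitCap isOpen_Iio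
  have hc := continuous_incidence (sourceDist e u R)
  have h1 : Continuous fun v : S2 =>
      impactPoint (sourceDist e u R) (sourceAxis e u R) (R • (u : E3)) v := by
    unfold impactPoint; fun_prop
  have h2 : Continuous fun v : S2 => scatter (sourceDist e u R) (sourceAxis e u R) v := by
    unfold scatter; fun_prop
  have h3 : ContinuousOn (fun v : S2 => centerB u R v) (hitCap e u R) := by
    have hsub : Continuous fun v : S2 => (u : E3) - v := by fun_prop
    refine continuousOn_const.add
      ((hsub.norm.continuousOn.inv₀ fun v hv => ?_).smul hsub.continuousOn)
    rw [norm_ne_zero_iff, sub_ne_zero]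
    exact fun h' => ne_of_mem_hitCap h hR hv (Subtype.ext h')
  exact ((h1.add (h2.const_smul t)).continuousOn.sub h3).norm

lemma measurableSet_simpleRecollision (h : u ≠ e) (hR : 0 < R) :
    MeasurableSet (simpleRecollision e u R) := by
  rw [simpleRecollision_eq h hR]
  exact isOpen_hitCap.measurableSet.diff (isOpen_multipleRecollision h hR).measurableSet

/-- After a grazing second visit to the first scatterer the particle moves away from the second
one. -/
lemma notMem_multipleRecollision_of_grazing (h : u ≠ e) (hR : 0 < R) {v : S2}
    (hi : incidence (sourceDist e u R) ⟪(v : E3), sourceAxis e u R⟫ < 1 / 4)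
    (hvu : ⟪(v : E3), (u : E3)⟫ < 0) : v ∉ multipleRecollision e u R := by
  rintro ⟨hv, t, ht, hlt⟩
  have hd := one_lt_sourceDist h hR
  have hz := norm_sourceAxis h hR
  have hs := source_eq h hR
  have huv := ne_of_mem_hitCap h hR hv
  obtain ⟨-, -, h2, h3⟩ := incidence_sq hd hv
  have hm := norm_impactPoint hz (norm_S2 v) hd hs hv
  have hn1 := norm_unitVector huv
  have hvn := inner_unitVector u v
  have hnb : centerB u R v = R • (u : E3) + ‖(u : E3) - v‖⁻¹ • ((u : E3) - v) := rfl
  set n := ‖(u : E3) - v‖⁻¹ • ((u : E3) - v)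
  have hu1 : 1 ≤ ‖(u : E3) - v‖ := by
    have := norm_sub_sq_S2 u v
    rw [real_inner_comm] at this
    nlinarith [norm_nonneg ((u : E3) - v)]
  -- The deflection has length 2σ < 1/2, where σ is the incidence cosine, while ⟪v, n⟫ ≤ -1/2.
  have hw : ⟪scatter (sourceDist e u R) (sourceAxis e u R) v, n⟫ ≤ 0 := by
    rw [scatter_eq hs, inner_add_left, hvn, inner_smul_left]
    have h4 := real_inner_le_norm
      (impactPoint (sourceDist e u R) (sourceAxis e u R) (R • (u : E3)) v - centerA e u) n
    rw [hm, hn1, one_mul] at h4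
    simp only [conj_trivial]
    nlinarith
  have hle := abs_real_inner_le_norm
    (impactPoint (sourceDist e u R) (sourceAxis e u R) (R • (u : E3)) v +
      t • scatter (sourceDist e u R) (sourceAxis e u R) v - centerB u R v) n
  rw [hn1, mul_one] at hle
  -- The second centre is `R • u + n`, whence the -1. Both flights have nonpositive component along
  -- `n`, so the particle never passes the tangent plane of the second ball at `R • u`.
  have heq : ⟪impactPoint (sourceDist e u R) (sourceAxis e u R) (R • (u : E3)) v +
      t • scatter (sourceDist e u R) (sourceAxis e u R) v - centerB u R v, n⟫ =
      (sourceDist e u R * ⟪(v : E3), sourceAxis e u R⟫ -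
        incidence (sourceDist e u R) ⟪(v : E3), sourceAxis e u R⟫) * ⟪(v : E3), n⟫ +
      t * ⟪scatter (sourceDist e u R) (sourceAxis e u R) v, n⟫ - 1 := by
    rw [hnb, impactPoint]
    simp only [inner_sub_left, inner_add_left, inner_smul_left, conj_trivial]
    rw [real_inner_self_eq_norm_sq, hn1]
    ring
  have h5 : (sourceDist e u R * ⟪(v : E3), sourceAxis e u R⟫ -
      incidence (sourceDist e u R) ⟪(v : E3), sourceAxis e u R⟫) * ⟪(v : E3), n⟫ ≤ 0 :=
    mul_nonpos_of_nonneg_of_nonpos (by linarith) (by rw [hvn]; linarith)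
  have h6 : t * ⟪scatter (sourceDist e u R) (sourceAxis e u R) v, n⟫ ≤ 0 :=
    mul_nonpos_of_nonneg_of_nonpos ht.le hw
  have h9 := hle.trans_lt hlt
  rw [heq, abs_lt] at h9
  linarith

lemma exists_grazing (h : u ≠ e) (hR : 0 < R) :
    ∃ v : S2, v ∈ hitCap e u R ∧
      incidence (sourceDist e u R) ⟪(v : E3), sourceAxis e u R⟫ < 1 / 4 ∧
      ⟪(v : E3), (u : E3)⟫ < 0 := by
  have hd := one_lt_sourceDist h hR
  have hz := norm_sourceAxis h hR
  obtain ⟨b, hb⟩ := exists_orthonormalBasis hz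
  set d := sourceDist e u R
  have hmem := sourceCos_mem hd (s := 1 / 8) (by norm_num)
  have hpos := sourceCos_pos hd (s := 1 / 8)
  have hneg := inner_sourceAxis_neg h hR
  have hc : sourceCos d (1 / 8) ∈ Set.Ioo (-1 : ℝ) 1 := ⟨by linarith, hmem.2⟩
  -- The axis already points away from `u`; azimuth 0 or π is chosen so that the transverse part
  -- does too.
  obtain ⟨φ, hsin, hcos⟩ : ∃ φ : ℝ, Real.sin φ = 0 ∧ Real.cos φ * ⟪b 1, (u : E3)⟫ ≤ 0 := by
    rcases le_total ⟪b 1, (u : E3)⟫ 0 with h1 | h1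
    · exact ⟨0, Real.sin_zero, by simpa using h1⟩
    · exact ⟨Real.pi, Real.sin_pi, by simpa using h1⟩
  refine ⟨⟨spherePoint b (sourceCos d (1 / 8)) φ, by simpa using norm_spherePoint b hc φ⟩,
    ?_, ?_, ?_⟩
  · change sourceCos d 0 < ⟪spherePoint b (sourceCos d (1 / 8)) φ, sourceAxis e u R⟫
    rw [← hb, inner_spherePoint]
    exact hmem.1
  · rw [← hb, inner_spherePoint, incidence_sourceCos hd (by norm_num)]
    norm_num
  · change ⟪spherePoint b (sourceCos d (1 / 8)) φ, (u : E3)⟫ < 0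
    rw [spherePoint, hsin, hb]
    simp only [zero_smul, add_zero, inner_add_left, inner_smul_left, conj_trivial]
    rw [real_inner_comm] at hneg
    have h1 := mul_neg_of_pos_of_neg hpos hneg
    have h2 := mul_nonpos_of_nonneg_of_nonpos
      (Real.sqrt_nonneg (1 - sourceCos d (1 / 8) ^ 2)) hcos
    linarith

lemma uni_simpleRecollision_pos (h : u ≠ e) (hR : 0 < R) :
    0 < uni (simpleRecollision e u R) := by
  have hc := continuous_incidence (sourceDist e u R)
  have hopen : IsOpen (hitCap e u R ∩
      ({v : S2 | incidence (sourceDist e u R) ⟪(v : E3), sourceAxis e u R⟫ < 1 / 4} ∩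
        {v : S2 | ⟪(v : E3), (u : E3)⟫ < 0})) :=
    isOpen_hitCap.inter ((isOpen_lt (by fun_prop) continuous_const).inter
      (isOpen_lt (by fun_prop) continuous_const))
  obtain ⟨v, h1, h2, h3⟩ := exists_grazing h hR
  have hpos : 0 < surface (hitCap e u R ∩
      ({v : S2 | incidence (sourceDist e u R) ⟪(v : E3), sourceAxis e u R⟫ < 1 / 4} ∩
        {v : S2 | ⟪(v : E3), (u : E3)⟫ < 0})) :=
    hopen.measure_pos (μ := (volume : Measure E3).toSphere) ⟨v, h1, h2, h3⟩
  rw [uni, Measure.smul_apply, smul_eq_mul]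
  refine ENNReal.mul_pos (by simp) (hpos.trans_le (measure_mono ?_)).ne'
  rw [simpleRecollision_eq h hR]
  rintro w ⟨h4, h5, h6⟩
  exact ⟨h4, notMem_multipleRecollision_of_grazing h hR h5 h6⟩

/-! ### Rarity of a fourth collision and the final estimate. -/

/-- A particle that visits both scatterers again leaves the first one almost in direction `u`. -/
lemma multipleRecollision_subset (h : u ≠ e) (hR : 4 ≤ R) :
    multipleRecollision e u R ⊆ scatterInto (sourceDist e u R) (sourceAxis e u R)
      {w : S2 | 1 - 16 / R ^ 2 < ⟪(w : E3), (u : E3)⟫} := by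
  have hR0 : 0 < R := by linarith
  rintro v ⟨hv, t, ht, hlt⟩
  have hd := one_lt_sourceDist h hR0
  have hz := norm_sourceAxis h hR0
  have hs := source_eq h hR0
  have huv := ne_of_mem_hitCap h hR0 hv
  have hm := norm_impactPoint hz (norm_S2 v) hd hs hv
  have hn1 := norm_unitVector huv
  have ha : ‖centerA e u‖ = 1 := norm_unitVector h.symm
  have hw := norm_scatter hz (norm_S2 v) hd hv
  have hnb : centerB u R v = R • (u : E3) + ‖(u : E3) - v‖⁻¹ • ((u : E3) - v) := rfl
  refine ⟨hv, ⟨scatter (sourceDist e u R) (sourceAxis e u R) v, by simpa using hw⟩, ?_, rfl⟩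
  change 1 - 16 / R ^ 2 < ⟪scatter (sourceDist e u R) (sourceAxis e u R) v, (u : E3)⟫
  set n := ‖(u : E3) - v‖⁻¹ • ((u : E3) - v)
  set y := impactPoint (sourceDist e u R) (sourceAxis e u R) (R • (u : E3)) v
  set w := scatter (sourceDist e u R) (sourceAxis e u R) v
  -- The difference is a sum of four vectors: three of norm 1, and one of norm less than 1, the
  -- position relative to the second centre.
  have h4 : ‖t • w - R • (u : E3)‖ < 4 := by
    have e1 : t • w - R • (u : E3) =
        (y + t • w - centerB u R v) + n - (y - centerA e u) - centerA e u := by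
      rw [hnb]; abel
    rw [e1]
    have i1 := norm_sub_le ((y + t • w - centerB u R v) + n - (y - centerA e u)) (centerA e u)
    have i2 := norm_sub_le ((y + t • w - centerB u R v) + n) (y - centerA e u)
    have i3 := norm_add_le (y + t • w - centerB u R v) n
    linarith
  have h5 : ‖t • w - R • (u : E3)‖ ^ 2 = t ^ 2 - 2 * t * R * ⟪w, (u : E3)⟫ + R ^ 2 := by
    rw [norm_sub_sq_real, norm_smul, norm_smul, hw, norm_S2, inner_smul_left, inner_smul_right,
      mul_one, mul_one, Real.norm_eq_abs, Real.norm_eq_abs, sq_abs, sq_abs]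
    simp only [conj_trivial]
    ring
  have h6 : t ^ 2 - 2 * t * R * ⟪w, (u : E3)⟫ + R ^ 2 < 16 := by
    rw [← h5]; nlinarith [norm_nonneg (t • w - R • (u : E3))]
  -- If ⟪w, u⟫ ≤ x, minimising over t gives a squared distance of at least R²(1 - x²) ≥ R²(1 - x) =
  -- 16.
  by_contra hx
  rw [not_lt] at hx
  set x := 1 - 16 / R ^ 2 with hxd
  have hxR : R ^ 2 * (1 - x) = 16 := by rw [hxd]; field_simp; ring
  have hx0 : 0 ≤ x := by
    have : 16 / R ^ 2 ≤ 1 := by rw [div_le_one (by positivity)]; nlinarith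
    linarith
  have h7 : t * R * ⟪w, (u : E3)⟫ ≤ t * R * x :=
    mul_le_mul_of_nonneg_left hx (mul_pos ht hR0).le
  have h8 : (1 - x) ≤ (1 - x) * (1 + x) := by
    have : 0 ≤ 1 - x := by rw [hxd]; simp; positivity
    nlinarith
  have h9 : R ^ 2 * (1 - x) ≤ R ^ 2 * ((1 - x) * (1 + x)) :=
    mul_le_mul_of_nonneg_left h8 (sq_nonneg R)
  nlinarith [sq_nonneg (t - R * x)]

/-- The cap around `u` has normalised measure 8/R² ≤ 8/R, and the isotropy error adds 5/d ≤ 5/R. -/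
lemma uni_real_multipleRecollision_le (h : u ≠ e) (hR : 4 ≤ R) :
    uni.real (multipleRecollision e u R) ≤ capFraction (sourceDist e u R) * (13 / R) := by
  have hR0 : 0 < R := by linarith
  have hd := le_sourceDist h hR0
  have hκ := capFraction_pos (one_lt_sourceDist h hR0)
  have h16 : 16 / R ^ 2 ≤ 1 := by
    rw [div_le_one (by positivity)]; nlinarith
  have h16' : (0 : ℝ) ≤ 16 / R ^ 2 := by positivity
  have hA : MeasurableSet {w : S2 | 1 - 16 / R ^ 2 < ⟪(w : E3), (u : E3)⟫} :=
    measurableSet_lt measurable_const (by fun_prop)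
  have h1 := (abs_le.1 (abs_uni_scatterInto_sub_le (norm_sourceAxis h hR0)
    (show 3 ≤ sourceDist e u R by linarith) hA)).2
  rw [uni_real_cap (norm_S2 u) (by linarith) (by linarith)] at h1
  have h2 : uni.real (multipleRecollision e u R) ≤ _ :=
    measureReal_mono (multipleRecollision_subset h hR)
  have h3 : (1 - (1 - 16 / R ^ 2)) / 2 + 5 / sourceDist e u R ≤ 13 / R := by
    have i1 : 5 / sourceDist e u R ≤ 5 / R := by gcongr
    have i2 : 8 / R ^ 2 ≤ 8 / R := by
      apply div_le_div_of_nonneg_left (by norm_num) hR0; nlinarith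
    have i3 : (1 - (1 - 16 / R ^ 2)) / 2 = 8 / R ^ 2 := by ring
    have i4 : 13 / R = 8 / R + 5 / R := by ring
    linarith
  have h4 := mul_le_mul_of_nonneg_left h3 hκ.le
  rw [mul_add] at h4
  linarith

lemma uni_real_hitCap (h : u ≠ e) (hR : 0 < R) :
    uni.real (hitCap e u R) = capFraction (sourceDist e u R) := by
  have hd := one_lt_sourceDist h hR
  have hκ := capFraction_pos hd
  rw [hitCap, uni_real_cap (norm_sourceAxis h hR) (by linarith [sourceCos_pos hd (s := 0)])
    (by unfold capFraction at hκ; linarith), capFraction]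

lemma condExitProb_eq (h : u ≠ e) (hR : 0 < R) (A : Set S2) :
    condExitProb e u R A = (uni.real (simpleRecollision e u R))⁻¹ *
      uni.real (scatterInto (sourceDist e u R) (sourceAxis e u R) A \
        multipleRecollision e u R) := by
  rw [condExitProb, measureReal_def,
    ProbabilityTheory.cond_apply (measurableSet_simpleRecollision h hR), ENNReal.toReal_mul,
    ENNReal.toReal_inv, ← measureReal_def, ← measureReal_def]
  congr 2
  ext v
  constructor
  · rintro ⟨h1, h2⟩
    rw [Set.mem_ofPred_eq, exitVelocity_eq h hR h1] at h2
    rw [simpleRecollision_eq h hR] at h1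
    exact ⟨⟨h1.1, h2⟩, h1.2⟩
  · rintro ⟨⟨h1, h2⟩, h3⟩
    have h4 : v ∈ simpleRecollision e u R := by
      rw [simpleRecollision_eq h hR]; exact ⟨h1, h3⟩
    refine ⟨h4, ?_⟩
    rw [Set.mem_ofPred_eq, exitVelocity_eq h hR h4]
    exact h2

lemma condExitProb_mem_Icc (h : u ≠ e) (hR : 0 < R) (A : Set S2) :
    condExitProb e u R A ∈ Set.Icc 0 1 := by
  have := ProbabilityTheory.cond_isProbabilityMeasure (uni_simpleRecollision_pos h hR).ne'
  exact ⟨measureReal_nonneg, measureReal_le_one⟩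

lemma abs_condExitProb_sub_le (h : u ≠ e) (hR : 0 < R) {A : Set S2} (hA : MeasurableSet A) :
    |condExitProb e u R A - uni.real A| ≤ 72 / (1 + R) := by
  have ha0 : 0 ≤ uni.real A := measureReal_nonneg
  have ha1 : uni.real A ≤ 1 := measureReal_le_one
  -- Below 26 the right-hand side exceeds 1. From 26 on, 13/R ≤ 1/2, so at least half of the hitting
  -- directions remain in the event.
  rcases lt_or_ge R 26 with hlt | hge
  · obtain ⟨h0, h1⟩ := condExitProb_mem_Icc h hR A
    have : 1 ≤ 72 / (1 + R) := by rw [le_div_iff₀ (by linarith)]; linarith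
    rw [abs_le]; constructor <;> linarith
  have hd := le_sourceDist h hR
  have hκ := capFraction_pos (one_lt_sourceDist h hR)
  have hG := (isOpen_multipleRecollision h hR).measurableSet
  have hI := abs_le.1 (abs_uni_scatterInto_sub_le (norm_sourceAxis h hR)
    (show 3 ≤ sourceDist e u R by linarith) hA)
  have hg := uni_real_multipleRecollision_le h (by linarith : 4 ≤ R)
  have hg0 : 0 ≤ uni.real (multipleRecollision e u R) := measureReal_nonneg
  have hq : uni.real (simpleRecollision e u R) =
      capFraction (sourceDist e u R) - uni.real (multipleRecollision e u R) := by
    have hsub : multipleRecollision e u R ⊆ hitCap e u R := fun v hv => hv.1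
    rw [simpleRecollision_eq h hR, measureReal_sdiff hsub hG, uni_real_hitCap h hR]
  have hP1 : uni.real (scatterInto (sourceDist e u R) (sourceAxis e u R) A \
      multipleRecollision e u R) ≤ uni.real (scatterInto (sourceDist e u R) (sourceAxis e u R) A) :=
    measureReal_mono Set.sdiff_subset
  have hP2 : uni.real (scatterInto (sourceDist e u R) (sourceAxis e u R) A) -
      uni.real (multipleRecollision e u R) ≤ uni.real (scatterInto (sourceDist e u R)
        (sourceAxis e u R) A \ multipleRecollision e u R) := le_measureReal_sdiff
  rw [condExitProb_eq h hR, hq]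
  set κ := capFraction (sourceDist e u R)
  set g := uni.real (multipleRecollision e u R)
  set P := uni.real (scatterInto (sourceDist e u R) (sourceAxis e u R) A \
      multipleRecollision e u R)
  set a := uni.real A
  have h5 : κ * (5 / sourceDist e u R) ≤ κ * (5 / R) := by gcongr
  have h13 : 13 / R ≤ 1 / 2 := by rw [div_le_iff₀ hR]; linarith
  have hqpos : κ / 2 ≤ κ - g := by
    have := mul_le_mul_of_nonneg_left h13 hκ.le
    linarith
  have hq0 : 0 < κ - g := by linarith
  have e1 : (κ - g)⁻¹ * P - a = (P - (κ - g) * a) / (κ - g) := by field_simp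
  have hsum : κ * (5 / R) + κ * (13 / R) = κ * (18 / R) := by ring
  have hga : g * a ≤ g := by nlinarith
  have hga0 : 0 ≤ g * a := mul_nonneg hg0 ha0
  -- The error 5/R comes from isotropy and 13/R from the removed directions; dividing by at least
  -- κ/2 doubles the sum to 36/R.
  have h18 : |P - (κ - g) * a| ≤ κ * (18 / R) := by
    rw [abs_le]; constructor <;> linarith [hI.1, hI.2]
  rw [e1, abs_div, abs_of_pos hq0, div_le_iff₀ hq0]
  calc _ ≤ κ * (18 / R) := h18
    _ = 36 / R * (κ / 2) := by ring
    _ ≤ 72 / (1 + R) * (κ / 2) := by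
      refine mul_le_mul_of_nonneg_right ?_ (by linarith)
      rw [div_le_div_iff₀ hR (by linarith)]; linarith
    _ ≤ _ := mul_le_mul_of_nonneg_left hqpos (by positivity)

end

end LorentzRecollision

end

theorem lemma2p6 :
    (∃ C : ℝ, 0 < C ∧
      ∀ (e u : LorentzRecollision.S2) (R : ℝ), u ≠ e → 0 < R →
        0 < LorentzRecollision.uni (LorentzRecollision.simpleRecollision e u R) ∧
        ∀ A : Set LorentzRecollision.S2, MeasurableSet A →
          |LorentzRecollision.condExitProb e u R A -
              LorentzRecollision.surface.real A / LorentzRecollision.surface.real Set.univ|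
            ≤ C / (1 + R)) ∧
    (∀ ε : ℝ, 0 < ε → ∃ R₀ : ℝ, 0 < R₀ ∧
      ∀ (e e' u u' : LorentzRecollision.S2) (R : ℝ), u ≠ e → u' ≠ e' → R₀ ≤ R →
        ∀ A : Set LorentzRecollision.S2, MeasurableSet A →
          |LorentzRecollision.condExitProb e u R A -
              LorentzRecollision.condExitProb e' u' R A| ≤ ε) := by
  refine ⟨⟨72, by norm_num, fun e u R h hR =>
    ⟨LorentzRecollision.uni_simpleRecollision_pos h hR, fun A hA => ?_⟩⟩, fun ε hε => ?_⟩
  · rw [LorentzRecollision.surface_real_univ, ← LorentzRecollision.uni_real]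
    exact LorentzRecollision.abs_condExitProb_sub_le h hR hA
  · refine ⟨144 / ε, by positivity, fun e e' u u' R h h' hR A hA => ?_⟩
    have hR0 : 0 < R := lt_of_lt_of_le (by positivity) hR
    have h1 := LorentzRecollision.abs_condExitProb_sub_le h hR0 hA
    have h2 := LorentzRecollision.abs_condExitProb_sub_le h' hR0 hA
    have h3 : 72 / (1 + R) ≤ ε / 2 := by
      rw [div_le_iff₀ hε] at hR
      rw [div_le_iff₀ (by linarith)]
      nlinarith
    rw [abs_le] at h1 h2 ⊢
    constructor <;> linarith [h1.1, h1.2, h2.1, h2.2]
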